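/- **Setting.** Let $S,A$ be measurable spaces, $\Omega=S\times A$, $P(ds'|s,a)$ a Markov transition kernel, $\pi(da|s)$ a policy, $\mu_0$ a probability measure on $S$, $\gamma\in(0,1]$, and $p$ a probability measure on $\Omega$ (the distribution of the state-action pairs in the data). Put $P^\pi(ds',da'|s,a)=P(ds'|s,a)\,\pi(da'|s')$, let $\mu_0\pi$ be the law of $(s,a)$ with $s\sim\mu_0$, $a\sim\pi(\cdot|s)$, let $\mathcal T_p$ be the law of $(x,x')$ with $x\sim p$, $x'\sim P^\pi(\cdot|x)$, and let $\mathcal T\circ\nu=(1-\gamma)\mu_0\pi+\gamma\int P^\pi(\cdot|x)\,\nu(dx)$. Let $\phi:[0,\infty)\to\mathbb R$ be convex and lower semicontinuous with $\phi(1)=0$, $\phi^*(y)=\sup_{x\ge0}(xy-\phi(x))$, $\lambda>0$, and $$J(\tau,u,f)=(1-\gamma)\mathbb E_{\mu_0\pi}[f]+\gamma\,\mathbb E_{(x,x')\sim\mathcal T_p}[\tau(x)f(x')]-\mathbb E_p[\tau\,\phi^*(f)]+\lambda\big(\mathbb E_p[u\tau-u]-\tfrac12u^2\big).$$ For a constant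 $C$ let $\mathcal F^*$ be the set of measurable $f:\Omega\to\mathbb R$ with $\|f\|_\infty\le C$, and put $J(\tau)=\sup_{f\in\mathcal F^*,\,u\in\mathbb R}J(\tau,u,f)$ and $D_\phi^C(\nu_1\|\nu_2)=\sup_{f\in\mathcal F^*}\big(\mathbb E_{\nu_1}[f]-\mathbb E_{\nu_2}[\phi^*(f)]\big)$. **Assumptions.** - $\phi^*$ is finite and $\kappa$-Lipschitz on $[-C,C]$. - $\mathcal T$ has a unique stationary distribution $\mu$, in the sense that $\mu$ is the only probability measure with $D_\phi^C(\mathcal T\circ\mu\|\mu)=0$. - $\mu\ll p$, and $\tau^*=d\mu/dp$ satisfies $\|\tau^*\|_\infty\le C$. - $\mathcal T\circ p\le B\,p$ for a finite constant $B$. - $\mathcal H$ is a class of measurable functions $\Omega\to[0,C]$, and $\mathcal F\subseteq\mathcal F^*$ is a non-empty class. Both classes are permissible (each is the set of sections of a jointly measurable function indexed by a standard Borel space), with pseudo-dimensions at most $D_{\mathcal H}<\infty$ and $D_{\mathcal F}<\infty$. **Estimator.** Let $N\ge2$ and let $(x_{0,i},x_i,x_i')_{i\le N}$ be i.i.d.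 triples with $x_{0,i}\sim\mu_0\pi$ and $(x_i,x_i')\sim\mathcal T_p$. Let $$\hat J(\tau,u,f)=\frac1N\sum_{i=1}^N\Big[(1-\gamma)f(x_{0,i})+\gamma\tau(x_i)f(x'_i)-\tau(x_i)\phi^*(f(x_i))+\lambda\big(u\tau(x_i)-u-\tfrac12u^2\big)\Big],$$ and $\hat L(\tau)=\sup_{f\in\mathcal F,\,u\in\mathbb R}\hat J(\tau,u,f)$. The GenDICE estimate $\hat\tau\in\mathcal H$ is the output of any (possibly randomized) optimization algorithm run on the data. Its expected optimization error is $\epsilon_{opt}=\mathbb E\big[\hat L(\hat\tau)-\inf_{\tau\in\mathcal H}\hat L(\tau)\big]$; the random variables $J(\hat\tau)$ and $\hat L(\hat\tau)-\inf_{\mathcal H}\hat L$ are assumed measurable. **Approximation errors.** With $U=[-(C+1),C+1]$, put $$\epsilon_{approx}(\mathcal F)=\sup_{f_1\in\mathcal F^*,\,u_1\in U}\ \inf_{f_2\in\mathcal F,\,u_2\in U}\Big(\int|f_1-f_2|\,dp+|u_1-u_2|\Big),\qquad \epsilon_{approx}(\mathcal H)=\sup_{0\le\tau_1\le C}\ \inf_{\tau_2\in\mathcal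 H}\int|\tau_1-\tau_2|\,dp .$$ **Theorem.** There is a constant $K\geq 0$ that depends only on $\phi,C,\kappa,\lambda,B,D_{\mathcal H},D_{\mathcal F}$ (and not on the spaces, the decision process, $p$, the classes, $N$ or the algorithm) such that $J(\hat\tau)-J(\tau^*)$ and $\hat L(\hat\tau)-\inf_{\mathcal H}\hat L$ are integrable and $$\mathbb E\big[J(\hat\tau)-J(\tau^*)\big]\ \le\ K\Big(\epsilon_{approx}(\mathcal F)+\epsilon_{approx}(\mathcal H)+\sqrt{\tfrac{\log N}{N}}\Big)+\epsilon_{opt},$$ where the expectation is over the data and the randomness of the algorithm. In particular $\mathbb E[J(\hat\tau)-J(\tau^*)]=\widetilde O\big(\epsilon_{approx}(\mathcal F,\mathcal H)+1/\sqrt N+\epsilon_{opt}\big)$ with $\epsilon_{approx}(\mathcal F,\mathcal H)=\epsilon_{approx}(\mathcal F)+\epsilon_{approx}(\mathcal H)$. -/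

import Mathlib

open MeasureTheory ProbabilityTheory Set

noncomputable section

namespace GenDICE

/-! ### Generators of divergences -/

/-- A generator of an `f`-divergence: a convex, lower semicontinuous function on `[0, ∞)` that
vanishes at `1` (values of `φ` at negative numbers are irrelevant). -/
structure IsDivergenceGenerator (φ : ℝ → ℝ) : Prop where
  convex : ConvexOn ℝ (Ici 0) φ
  lsc : LowerSemicontinuousOn φ (Ici 0)
  one : φ 1 = 0

/-- The Fenchel conjugate `φ*(y) = sup_{x ≥ 0} (x y - φ(x))` (meaningful where the supremum is
finite, see `ConjFiniteOn`). -/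
def conj (φ : ℝ → ℝ) (y : ℝ) : ℝ := sSup ((fun x => x * y - φ x) '' Ici 0)

/-- The Fenchel conjugate is finite at every point of `s`. -/
def ConjFiniteOn (φ : ℝ → ℝ) (s : Set ℝ) : Prop :=
  ∀ y ∈ s, BddAbove ((fun x => x * y - φ x) '' Ici 0)

/-! ### Function classes -/

section FunctionClasses

variable {X : Type*}

/-- A finite set `s` of points is pseudo-shattered by the class `G`: for suitable thresholds `r`,
every above/below pattern on `s` is realized by a member of `G`. -/
def PseudoShatters (G : Set (X → ℝ)) (s : Finset X) : Prop :=
  ∃ r : X → ℝ, ∀ t ⊆ s, ∃ g ∈ G, ∀ x ∈ s, r x < g x ↔ x ∈ t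

/-- The pseudo-dimension of a class of real functions: the supremum of the cardinalities of the
finite sets it pseudo-shatters. -/
def pseudoDim (G : Set (X → ℝ)) : ℕ∞ := ⨆ (s : Finset X) (_ : PseudoShatters G s), (s.card : ℕ∞)

/-- A permissible class of functions (the usual measurability condition for uniform laws of large
numbers): it is the set of sections of a jointly measurable function whose index ranges over a
standard Borel space. In particular its members are measurable. -/
def Permissible [MeasurableSpace X] (G : Set (X → ℝ)) : Prop :=
  ∃ (T : Type) (_ : MeasurableSpace T) (_ : StandardBorelSpace T) (g : T → X → ℝ),
    Measurable (Function.uncurry g) ∧ range g = G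

/-- The measurable dual functions with `‖f‖_∞ ≤ C`. -/
def dualBall [MeasurableSpace X] (C : ℝ) : Set (X → ℝ) := {f | Measurable f ∧ ∀ x, |f x| ≤ C}

/-- The measurable non-negative functions with `‖τ‖_∞ ≤ C`. -/
def ratioBall [MeasurableSpace X] (C : ℝ) : Set (X → ℝ) :=
  {τ | Measurable τ ∧ ∀ x, 0 ≤ τ x ∧ τ x ≤ C}

/-- The divergence `D_φ^C(ν₁ ‖ ν₂) = sup_{‖f‖_∞ ≤ C} (E_{ν₁}[f] - E_{ν₂}[φ*(f)])`. -/
def boundedDiv [MeasurableSpace X] (φ : ℝ → ℝ) (C : ℝ) (ν₁ ν₂ : Measure X) : ℝ :=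
  sSup ((fun f : X → ℝ => ∫ x, f x ∂ν₁ - ∫ x, conj φ (f x) ∂ν₂) '' dualBall C)

/-- The interval `U = [-(C+1), C+1]` for the scalar dual variable. -/
def dualInterval (C : ℝ) : Set ℝ := Icc (-(C + 1)) (C + 1)

/-- `ε_approx(F) = sup_{‖f₁‖_∞ ≤ C, u₁ ∈ U} inf_{f₂ ∈ F, u₂ ∈ U} (∫ |f₁ - f₂| dp + |u₁ - u₂|)`. -/
def approxErrorDual [MeasurableSpace X] (p : Measure X) (C : ℝ) (F : Set (X → ℝ)) : ℝ :=
  sSup ((fun q : (X → ℝ) × ℝ =>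
    sInf ((fun r : (X → ℝ) × ℝ => ∫ x, |q.1 x - r.1 x| ∂p + |q.2 - r.2|) ''
      (F ×ˢ dualInterval C))) '' (dualBall C ×ˢ dualInterval C))

/-- `ε_approx(H) = sup_{0 ≤ τ₁ ≤ C} inf_{τ₂ ∈ H} ∫ |τ₁ - τ₂| dp`. -/
def approxErrorRatio [MeasurableSpace X] (p : Measure X) (C : ℝ) (H : Set (X → ℝ)) : ℝ :=
  sSup ((fun τ₁ : X → ℝ => sInf ((fun τ₂ : X → ℝ => ∫ x, |τ₁ x - τ₂ x| ∂p) '' H)) '' ratioBall C)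

end FunctionClasses

/-! ### The off-policy estimation problem -/

/-- The data of the problem: transition kernel, target policy, initial state distribution, discount
factor `γ ∈ (0, 1]`, and the distribution `p` of the state-action pairs in the data set. -/
structure Problem (S A : Type*) [MeasurableSpace S] [MeasurableSpace A] where
  trans : Kernel (S × A) S
  policy : Kernel S A
  init : Measure S
  gamma : ℝ
  data : Measure (S × A)
  isMarkovKernel_trans : IsMarkovKernel trans
  isMarkovKernel_policy : IsMarkovKernel policy
  isProbabilityMeasure_init : IsProbabilityMeasure init
  isProbabilityMeasure_data : IsProbabilityMeasure data
  gamma_pos : 0 < gamma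
  gamma_le_one : gamma ≤ 1

namespace Problem

variable {S A : Type*} [MeasurableSpace S] [MeasurableSpace A]

/-- The state-action transition kernel `P^π(s', a' | s, a) = π(a' | s') P(s' | s, a)`. -/
def pairKernel (M : Problem S A) : Kernel (S × A) (S × A) :=
  M.trans ⊗ₖ Kernel.prodMkLeft (S × A) M.policy

/-- The initial state-action distribution `μ₀ π`. -/
def initPair (M : Problem S A) : Measure (S × A) := M.init ⊗ₘ M.policy

/-- The law `T_p` of `(x, x')` with `x ∼ p` and `x' ∼ P^π(· | x)`. -/
def pairLaw (M : Problem S A) : Measure ((S × A) × (S × A)) := M.data ⊗ₘ M.pairKernel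

/-- The operator `T ∘ ν = (1 - γ) μ₀ π + γ ∫ P^π(· | x) ν(dx)`. -/
def op (M : Problem S A) (ν : Measure (S × A)) : Measure (S × A) :=
  ENNReal.ofReal (1 - M.gamma) • M.initPair + ENNReal.ofReal M.gamma • ν.bind M.pairKernel

/-- `μ` is the unique stationary distribution of `T`, in the sense of the bounded divergence:
it is the only probability measure with `D_φ^C(T ∘ μ ‖ μ) = 0`. -/
structure IsUniqueStationary (M : Problem S A) (φ : ℝ → ℝ) (C : ℝ) (μ : Measure (S × A)) :
    Prop where
  isProbabilityMeasure : IsProbabilityMeasure μ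
  stationary : boundedDiv φ C (M.op μ) μ = 0
  unique : ∀ ν : Measure (S × A), IsProbabilityMeasure ν → boundedDiv φ C (M.op ν) ν = 0 → ν = μ

/-- The correction ratio `dμ/dp`. -/
def ratio (M : Problem S A) (μ : Measure (S × A)) (x : S × A) : ℝ := (μ.rnDeriv M.data x).toReal

/-- The saddle-point objective `J(τ, u, f)`. -/
def saddle (M : Problem S A) (φ : ℝ → ℝ) (lam : ℝ) (τ : S × A → ℝ) (u : ℝ) (f : S × A → ℝ) : ℝ :=
  (1 - M.gamma) * ∫ x, f x ∂M.initPair + M.gamma * ∫ z, τ z.1 * f z.2 ∂M.pairLaw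
    - ∫ x, τ x * conj φ (f x) ∂M.data + lam * (∫ x, (u * τ x - u) ∂M.data - u ^ 2 / 2)

/-- The summand of the empirical objective at a sample `z = (x₀, x, x')`. -/
def loss (M : Problem S A) (φ : ℝ → ℝ) (lam : ℝ) (τ : S × A → ℝ) (u : ℝ) (f : S × A → ℝ)
    (z : (S × A) × (S × A) × (S × A)) : ℝ :=
  (1 - M.gamma) * f z.1 + M.gamma * (τ z.2.1 * f z.2.2) - τ z.2.1 * conj φ (f z.2.1)
    + lam * (u * τ z.2.1 - u - u ^ 2 / 2)

/-- The empirical objective on the samples `z 0, …, z (N - 1)`. -/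
def empSaddle (M : Problem S A) (φ : ℝ → ℝ) (lam : ℝ) {N : ℕ}
    (z : Fin N → (S × A) × (S × A) × (S × A)) (τ : S × A → ℝ) (u : ℝ) (f : S × A → ℝ) : ℝ :=
  (∑ i, M.loss φ lam τ u f (z i)) / N

/-- `J(τ) = sup_{‖f‖_∞ ≤ C, u ∈ ℝ} J(τ, u, f)`. -/
def objective (M : Problem S A) (φ : ℝ → ℝ) (lam C : ℝ) (τ : S × A → ℝ) : ℝ :=
  sSup ((fun q : (S × A → ℝ) × ℝ => M.saddle φ lam τ q.2 q.1) '' (dualBall C ×ˢ univ))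

/-- The empirical primal objective `sup_{f ∈ F, u ∈ ℝ}` of the empirical saddle objective. -/
def empObjective (M : Problem S A) (φ : ℝ → ℝ) (lam : ℝ) (F : Set (S × A → ℝ)) {N : ℕ}
    (z : Fin N → (S × A) × (S × A) × (S × A)) (τ : S × A → ℝ) : ℝ :=
  sSup ((fun q : (S × A → ℝ) × ℝ => M.empSaddle φ lam z τ q.2 q.1) '' (F ×ˢ univ))

/-- The optimization error of `τ`: its empirical primal objective minus the optimal value
over `H`. -/
def optError (M : Problem S A) (φ : ℝ → ℝ) (lam : ℝ) (H F : Set (S × A → ℝ)) {N : ℕ}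
    (z : Fin N → (S × A) × (S × A) × (S × A)) (τ : S × A → ℝ) : ℝ :=
  M.empObjective φ lam F z τ - sInf (M.empObjective φ lam F z '' H)

/-- `Z` is an i.i.d. sample of triples `(x₀, x, x')` with `x₀ ∼ μ₀ π` and `(x, x') ∼ T_p`
(nothing is required of the dependence between `x₀` and `(x, x')` within one triple). -/
structure IsSample (M : Problem S A) {Ξ : Type*} [MeasurableSpace Ξ] (Q : Measure Ξ) {N : ℕ}
    (Z : Fin N → Ξ → (S × A) × (S × A) × (S × A)) : Prop where
  measurable : ∀ i, Measurable (Z i)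
  indep : iIndepFun Z Q
  ident : ∀ i j, Q.map (Z i) = Q.map (Z j)
  law_init : ∀ i, Q.map (fun ξ => (Z i ξ).1) = M.initPair
  law_pair : ∀ i, Q.map (fun ξ => (Z i ξ).2) = M.pairLaw

end Problem

end GenDICE

end

/-! The error is split along the chain $J(\hat\tau)\to\hat L(\hat\tau)\to\hat L(\tau_0)\to
J(\tau_0)\to J(\tau^*)$, where $\tau_0\in\mathcal H$ is a nearly best $L^1(p)$ approximation of
$\tau^*$ (`IsTripleLaw.objective_sub_le`). The second link costs the optimization error, the last
one $\epsilon_{approx}(\mathcal H)$; the first and third cost uniform deviations of empirical means,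
the first also $\epsilon_{approx}(\mathcal F)$.

In $J$ and in $\hat L$ the scalar $u$ enters only through $\lambda(u(a-1)-u^2/2)$, with $a$ the mean
or sample mean of $\tau$. The optimum $u=a-1$ is explicit and bounded by $C+1$, so a change of $a$
costs at most $\lambda(C+1)$ times its size (`dualValue_le_dualValue`). A change of $f$ is felt at
$x$, but also at $x_0$ and $x'$; the weighted marginals of these two form $\mathcal T\circ p\le Bp$,
so the $L^1(p)$ distance controls all three (`IsTripleLaw.integral_op_le`).

The expected uniform deviation is bounded by symmetrization with a ghost sample and Massart's lemma
on a finite net (`exists_uniform_deviation_bound`). On the sample points a class is discretized by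
$N$ thresholds; the resulting level patterns have VC dimension at most the pseudo-dimension, so
Sauer–Shelah gives nets of scale $2C/N$ and polynomial cardinality (`exists_finset_net`). Their
log-cardinality is $O(\log N)$, which yields $\sqrt{\log N/N}$ without chaining.

Suprema over uncountable classes must be integrated. Their superlevel sets are projections of
measurable sets along a standard Borel index space, hence universally measurable, because analytic
sets are (`aemeasurable_iSup_of_standardBorel`). -/

noncomputable section

namespace GenDICE

/-! ### Measurable projections -/

section Projection

open Filter Topology

/-- A continuous image of the Baire space can be approximated from inside by compact sets. -/
theorem exists_isCompact_subset_range {α : Type*} [TopologicalSpace α] [PolishSpace α]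
    [MeasurableSpace α] [BorelSpace α] (μ : Measure α) [IsFiniteMeasure μ]
    {f : (ℕ → ℕ) → α} (hf : Continuous f) {c : ENNReal} (hc : c < μ (range f)) :
    ∃ K ⊆ range f, IsCompact K ∧ c ≤ μ K := by
  -- Continuity from below holds for increasing unions of arbitrary sets, so one coordinate can be
  -- bounded while the image keeps measure above `c`.
  have step : ∀ (B : {B : Set (ℕ → ℕ) // c < μ (f '' B)}) (i : ℕ),
      ∃ n, c < μ (f '' (B.1 ∩ {x | x i ≤ n})) := by
    rintro ⟨B, hB⟩ i
    have hmono : Monotone fun n => f '' (B ∩ {x | x i ≤ n}) := by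
      intro m n hmn
      refine image_mono fun x hx => ⟨hx.1, ?_⟩
      exact le_trans (show x i ≤ m from hx.2) hmn
    have hU : f '' B = ⋃ n, f '' (B ∩ {x | x i ≤ n}) := by
      rw [← image_iUnion, ← inter_iUnion]
      congr 1
      refine (inter_eq_left.2 fun x _ => ?_).symm
      exact mem_iUnion.2 ⟨x i, le_refl (x i)⟩
    rw [hU, hmono.measure_iUnion, lt_iSup_iff] at hB
    exact hB
  choose n hn using step
  let Bs : ℕ → {B : Set (ℕ → ℕ) // c < μ (f '' B)} := fun k =>
    Nat.rec ⟨univ, by rwa [image_univ]⟩ (fun k B => ⟨B.1 ∩ {x | x k ≤ n B k}, hn B k⟩) k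
  let l : ℕ → ℕ := fun k => n (Bs k) k
  have hBs : ∀ k, ∀ x, x ∈ (Bs k).1 → ∀ i < k, x i ≤ l i := by
    intro k
    induction k with
    | zero => intro x _ i hi; omega
    | succ k ih =>
      intro x hx i hi
      have hx' : x ∈ (Bs k).1 ∩ {x | x k ≤ l k} := hx
      rcases Nat.lt_succ_iff_lt_or_eq.1 hi with h | rfl
      · exact ih x hx'.1 i h
      · exact hx'.2
  have hbox : IsCompact (Set.pi univ fun i => Iic (l i)) :=
    isCompact_univ_pi fun i => (Set.finite_Iic (l i)).isCompact
  refine ⟨f '' Set.pi univ fun i => Iic (l i), image_subset_range _ _, hbox.image hf, ?_⟩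
  -- By outer regularity only open `U` containing the compact image matter. Every `Bs k` has image
  -- of measure above `c`, so it suffices that one of these images lies in `U`.
  rw [Set.measure_eq_iInf_isOpen]
  refine le_iInf₂ fun U hU => le_iInf fun hUo => ?_
  suffices h : ∃ k, (Bs k).1 ⊆ f ⁻¹' U by
    obtain ⟨k, hk⟩ := h
    exact (Bs k).2.le.trans (measure_mono (image_subset_iff.2 hk))
  by_contra! hcon
  have hcon' : ∀ k, ∃ x, x ∈ (Bs k).1 ∧ x ∉ f ⁻¹' U := fun k => not_subset.1 (hcon k)
  choose x hxB hxU using hcon'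
  -- Truncation moves `x k` into the compact box and leaves the coordinates below `k` unchanged.
  -- Along a subsequence the original points therefore also converge to a point of the box, which
  -- lies outside the preimage of `U`.
  let y : ℕ → ℕ → ℕ := fun k i => min (x k i) (l i)
  have hy : ∀ k, y k ∈ Set.pi univ fun i => Iic (l i) := fun k i _ =>
    mem_Iic.2 (min_le_right _ _)
  obtain ⟨a, ha, s, hs, hlim⟩ := hbox.tendsto_subseq hy
  have hlimx : Tendsto (fun k => x (s k)) atTop (𝓝 a) := by
    rw [tendsto_pi_nhds] at hlim ⊢
    intro i
    refine (hlim i).congr' ?_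
    filter_upwards [eventually_gt_atTop i] with k hk
    exact min_eq_left (hBs _ _ (hxB (s k)) i (hk.trans_le (hs.id_le k)))
  have hcl : IsClosed (f ⁻¹' U)ᶜ := (hUo.preimage hf).isClosed_compl
  exact hcl.mem_of_tendsto hlimx (Eventually.of_forall fun k => hxU (s k))
    (hU (mem_image_of_mem f ha))

/-- Analytic sets are universally measurable. -/
theorem nullMeasurableSet_of_analyticSet {α : Type*} [TopologicalSpace α] [PolishSpace α]
    [MeasurableSpace α] [BorelSpace α] (μ : Measure α) [IsFiniteMeasure μ]
    {s : Set α} (hs : AnalyticSet s) : NullMeasurableSet s μ := by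
  rw [AnalyticSet] at hs
  rcases hs with rfl | ⟨f, hf, rfl⟩
  · exact MeasurableSet.empty.nullMeasurableSet
  rcases eq_or_ne (μ (range f)) 0 with h0 | h0
  · exact NullMeasurableSet.of_null h0
  obtain ⟨u, -, hu, hlim⟩ := exists_seq_strictMono_tendsto' (pos_iff_ne_zero.2 h0)
  have hK := fun n => exists_isCompact_subset_range μ hf (hu n).2
  choose K hKsub hKc hKm using hK
  have hmeas : MeasurableSet (⋃ n, K n) :=
    MeasurableSet.iUnion fun n => (hKc n).isClosed.measurableSet
  have hle : μ (range f) ≤ μ (⋃ n, K n) :=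
    le_of_tendsto' hlim fun n => (hKm n).trans (measure_mono (subset_iUnion K n))
  have hae : (⋃ n, K n : Set α) =ᵐ[μ] range f :=
    ae_eq_of_subset_of_measure_ge (iUnion_subset hKsub) hle hmeas.nullMeasurableSet
      (measure_ne_top μ _)
  exact hmeas.nullMeasurableSet.congr hae

/-- A measurable subset of a product is pulled back from a product with the Cantor space. -/
theorem exists_preimage_prodMap_cantor {T Ω : Type*} [MeasurableSpace T] [MeasurableSpace Ω]
    {B : Set (T × Ω)} (hB : MeasurableSet B) :
    ∃ (h : Ω → ℕ → Bool) (B' : Set (T × (ℕ → Bool))), Measurable h ∧ MeasurableSet B' ∧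
      B = Prod.map id h ⁻¹' B' := by
  rw [← generateFrom_prod] at hB
  induction B, hB using MeasurableSpace.generateFrom_induction with
  | hC B hB _ =>
    obtain ⟨s, hs, t, ht, rfl⟩ := hB
    classical
    have hs' : MeasurableSet s := hs
    have ht' : MeasurableSet t := ht
    refine ⟨fun ω _ => decide (ω ∈ t), s ×ˢ {y | y 0 = true}, ?_, ?_, ?_⟩
    · refine measurable_pi_lambda _ fun _ => ?_
      exact measurable_to_bool (by simpa [preimage] using ht')
    · refine hs'.prod ?_
      exact measurable_pi_apply (X := fun _ : ℕ => Bool) 0 (measurableSet_singleton true)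
    · ext ⟨a, b⟩; simp
  | empty => exact ⟨fun _ _ => true, ∅, measurable_const, MeasurableSet.empty, by simp⟩
  | compl B _ ih =>
    obtain ⟨h, B', hh, hB', rfl⟩ := ih
    exact ⟨h, B'ᶜ, hh, hB'.compl, by simp⟩
  | iUnion B _ ih =>
    choose h B' hh hB' heq using ih
    -- Countably many coding maps are interleaved into one by the pairing function; `proj k`
    -- recovers the `k`-th.
    let proj : ℕ → (ℕ → Bool) → ℕ → Bool := fun k y j => y (Nat.pair k j)
    have hproj : ∀ k, Measurable (proj k) := fun k =>
      measurable_pi_lambda _ fun j => measurable_pi_apply _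
    refine ⟨fun ω m => h m.unpair.1 ω m.unpair.2, ⋃ k, Prod.map id (proj k) ⁻¹' B' k, ?_, ?_, ?_⟩
    · exact measurable_pi_lambda _ fun m => (measurable_pi_apply _).comp (hh _)
    · exact MeasurableSet.iUnion fun k => (measurable_id.prodMap (hproj k)) (hB' k)
    · rw [preimage_iUnion]
      refine iUnion_congr fun k => ?_
      rw [heq k, ← preimage_comp]
      congr 1
      ext ⟨a, b⟩ <;> simp [proj]

/-- Measurable projection theorem: the projection along a standard Borel space of a measurable set
is universally measurable. -/
theorem nullMeasurableSet_snd_image {T Ω : Type*} [MeasurableSpace T] [StandardBorelSpace T]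
    [MeasurableSpace Ω] (ν : Measure Ω) [IsFiniteMeasure ν] {B : Set (T × Ω)}
    (hB : MeasurableSet B) : NullMeasurableSet (Prod.snd '' B) ν := by
  -- `Ω` is an abstract measurable space. Passing to the Cantor space with the image measure makes
  -- the projection an analytic subset of a Polish space.
  obtain ⟨h, B', hh, hB', rfl⟩ := exists_preimage_prodMap_cantor hB
  have heq : Prod.snd '' (Prod.map id h ⁻¹' B') = h ⁻¹' (Prod.snd '' B') := by
    ext ω
    constructor
    · rintro ⟨⟨t, ω'⟩, hmem, rfl⟩
      exact ⟨(t, h ω'), hmem, rfl⟩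
    · rintro ⟨⟨t, y⟩, hmem, hy⟩
      refine ⟨(t, ω), ?_, rfl⟩
      have : y = h ω := hy
      subst this
      exact hmem
  rw [heq]
  have : PolishSpace (ℕ → Bool) := {}
  have han : AnalyticSet (Prod.snd '' B') := hB'.analyticSet_image measurable_snd
  exact (nullMeasurableSet_of_analyticSet (ν.map h) han).preimage
    (hh.measurePreserving ν).quasiMeasurePreserving

/-- The supremum of a jointly measurable family indexed by a standard Borel space is
universally measurable. -/
theorem aemeasurable_iSup_of_standardBorel {T Ω : Type*} [MeasurableSpace T]
    [StandardBorelSpace T] [MeasurableSpace Ω] (ν : Measure Ω) [IsFiniteMeasure ν]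
    {g : T × Ω → ENNReal} (hg : Measurable g) : AEMeasurable (fun ω => ⨆ t, g (t, ω)) ν := by
  refine NullMeasurable.aemeasurable ?_
  have : @Measurable (NullMeasurableSpace Ω ν) ENNReal _ _ (fun ω => ⨆ t, g (t, ω)) := by
    refine @measurable_of_Ioi _ _ _ _ _ _ _ _ _ _ fun c => ?_
    -- A supremum exceeds `c` exactly when some member does, so the superlevel set is a projection.
    have heq : (fun ω => ⨆ t, g (t, ω)) ⁻¹' Ioi c = Prod.snd '' (g ⁻¹' Ioi c) := by
      ext ω
      simp [lt_iSup_iff]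
    have hnull := nullMeasurableSet_snd_image ν (hg (measurableSet_Ioi (a := c)))
    rw [← heq] at hnull
    exact hnull
  exact fun s hs => this hs

end Projection

/-! ### Finite nets of classes of finite pseudo-dimension -/

section Nets

/-- Makes the Sauer–Shelah sum polynomial: each term is dominated by the matching term of the
binomial expansion. -/
theorem sum_choose_le_succ_pow (n d : ℕ) : ∑ k ∈ Finset.Iic d, n.choose k ≤ (n + 1) ^ d := by
  have h : Finset.Iic d = Finset.range (d + 1) := by ext; simp
  rw [h, add_pow]
  refine Finset.sum_le_sum fun k hk => ?_
  have hk' : k ≤ d := Nat.lt_succ_iff.1 (Finset.mem_range.1 hk)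
  rw [one_pow, mul_one]
  exact (Nat.choose_le_pow n k).trans (Nat.le_mul_of_pos_right _ (Nat.choose_pos hk'))

variable {X T : Type*}

theorem card_le_of_pseudoShatters {G : Set (X → ℝ)} {d : ℕ} (hd : pseudoDim G ≤ d)
    {s : Finset X} (hs : PseudoShatters G s) : s.card ≤ d := by
  have h : (s.card : ℕ∞) ≤ pseudoDim G :=
    le_iSup₂ (f := fun (s : Finset X) (_ : PseudoShatters G s) => (s.card : ℕ∞)) s hs
  exact_mod_cast h.trans hd

/-- The level pattern of `g` on `P` with respect to the thresholds `c`. -/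
def levelPattern (P : Finset X) {m : ℕ} (c : Fin m → ℝ) (g : X → ℝ) : Finset (P × Fin m) :=
  open Classical in Finset.univ.filter fun q => c q.2 < g q.1

theorem mem_levelPattern {P : Finset X} {m : ℕ} {c : Fin m → ℝ} {g : X → ℝ} {q : P × Fin m} :
    q ∈ levelPattern P c g ↔ c q.2 < g q.1 := by
  simp [levelPattern]

open Classical in
/-- The family of level patterns of a class has a VC dimension bounded by the pseudo-dimension. -/
theorem card_le_of_shatters_levelPattern {G : T → X → ℝ} {d : ℕ}
    (hd : pseudoDim (range G) ≤ d) (P : Finset X) {m : ℕ} {c : Fin m → ℝ} (hc : Monotone c)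
    {𝒜 : Finset (Finset (P × Fin m))} (h𝒜 : ∀ a ∈ 𝒜, ∃ t, levelPattern P c (G t) = a)
    {s : Finset (P × Fin m)} (hs : 𝒜.Shatters s) : s.card ≤ d := by
  -- Two thresholds at one point cannot both occur in a shattered set: a function above the higher
  -- one is above the lower one, so the singleton of the higher pair is not a trace.
  have hlt : ∀ q ∈ s, ∀ q' ∈ s, (q.1 : X) = q'.1 → ¬ q.2 < q'.2 := by
    intro q hq q' hq' hx hj
    obtain ⟨u, hu, hsu⟩ := hs (Finset.singleton_subset_iff.2 hq')
    obtain ⟨t, rfl⟩ := h𝒜 u hu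
    have h1 : q' ∈ s ∩ levelPattern P c (G t) := by rw [hsu]; simp
    have h2 := mem_levelPattern.1 (Finset.mem_inter.1 h1).2
    have h3 : q ∈ s ∩ levelPattern P c (G t) := by
      refine Finset.mem_inter.2 ⟨hq, mem_levelPattern.2 ?_⟩
      rw [hx]
      exact (hc hj.le).trans_lt h2
    rw [hsu, Finset.mem_singleton] at h3
    exact absurd hj (by rw [h3]; exact lt_irrefl _)
  have hinj : InjOn (fun q : P × Fin m => (q.1 : X)) s := by
    intro q hq q' hq' hx
    refine Prod.ext (Subtype.ext hx) ?_
    exact le_antisymm (not_lt.1 (hlt q' hq' q hq hx.symm)) (not_lt.1 (hlt q hq q' hq' hx))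
  -- The shattered pairs thus form the graph of a function of the point, and this function supplies
  -- the thresholds for pseudo-shattering.
  have hr : ∀ x : X, ∃ v : ℝ, ∀ q ∈ s, (q.1 : X) = x → v = c q.2 := by
    intro x
    by_cases h : ∃ q ∈ s, (q.1 : X) = x
    · obtain ⟨q, hq, rfl⟩ := h
      exact ⟨c q.2, fun q' hq' hx => by rw [hinj hq' hq hx]⟩
    · push Not at h
      exact ⟨0, fun q hq hx => absurd hx (h q hq)⟩
  choose r hr using hr
  rw [← Finset.card_image_of_injOn hinj]
  refine card_le_of_pseudoShatters hd ⟨r, fun t _ => ?_⟩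
  obtain ⟨u, hu, hsu⟩ := hs (Finset.filter_subset (fun q => (q.1 : X) ∈ t) s)
  obtain ⟨i, rfl⟩ := h𝒜 u hu
  refine ⟨G i, mem_range_self i, fun x hx => ?_⟩
  obtain ⟨q, hq, rfl⟩ := Finset.mem_image.1 hx
  rw [hr _ q hq rfl]
  have := congrArg (fun w => q ∈ w) hsu
  simpa [hq, mem_levelPattern] using this

/-- A class of functions bounded by `C` of pseudo-dimension at most `d` has, on `n` points, a
uniform net of scale `2 C / m` with at most `(n m + 1) ^ d` elements. -/
theorem exists_finset_net {G : T → X → ℝ} {d : ℕ} (hd : pseudoDim (range G) ≤ d) {C : ℝ}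
    (hG : ∀ t x, |G t x| ≤ C) (P : Finset X) {n : ℕ} (hn : P.card ≤ n) {m : ℕ} (hm : 0 < m) :
    ∃ s : Finset T, s.card ≤ (n * m + 1) ^ d ∧
      ∀ t, ∃ t' ∈ s, ∀ x ∈ P, |G t x - G t' x| ≤ 2 * C / m := by
  classical
  rcases isEmpty_or_nonempty T with hT | hT
  · exact ⟨∅, by simp, fun t => hT.elim t⟩
  rcases P.eq_empty_or_nonempty with rfl | ⟨x₀, hx₀⟩
  · exact ⟨{hT.some}, by simpa using Nat.one_le_pow _ _ (Nat.succ_pos _),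
      fun t => ⟨_, Finset.mem_singleton_self _, by simp⟩⟩
  have hC : 0 ≤ C := (abs_nonneg _).trans (hG hT.some x₀)
  have hm' : (0 : ℝ) < m := by exact_mod_cast hm
  set δ : ℝ := 2 * C / m with hδ
  have hδ0 : 0 ≤ δ := by positivity
  -- Equally spaced thresholds starting at `-C`; the end point `C` is omitted because no value
  -- exceeds it.
  let c : Fin m → ℝ := fun j => -C + δ * (j : ℕ)
  have hc : Monotone c := by
    intro i j hij
    have : ((i : ℕ) : ℝ) ≤ (j : ℕ) := by exact_mod_cast hij
    simp only [c]
    gcongr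
  let pat : T → Finset (P × Fin m) := fun t => levelPattern P c (G t)
  have hle : ∀ t t', pat t = pat t' → ∀ x ∈ P, G t x ≤ G t' x + δ := by
    intro t t' h x hx
    by_contra! hlt
    have hδpos : 0 < δ := by
      rcases hδ0.eq_or_lt with h0 | h0
      · have hC0 : C = 0 := by
          rw [hδ] at h0
          have := h0.symm
          rw [div_eq_zero_iff] at this
          rcases this with h | h
          · linarith
          · exact absurd h hm'.ne'
        have h1 := abs_le.1 (hG t x)
        have h2 := abs_le.1 (hG t' x)
        rw [← h0] at hlt
        linarith
      · exact h0
    have h1 := abs_le.1 (hG t x)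
    have h2 := abs_le.1 (hG t' x)
    have hy : 0 ≤ (G t' x + C) / δ := div_nonneg (by linarith) hδ0
    have hceil := Nat.ceil_lt_add_one hy
    have hceil' := Nat.le_ceil ((G t' x + C) / δ)
    -- The first grid level not below `G t' x`. It lies below `G t' x + δ`, hence below `G t x`, so
    -- it separates the two patterns; it also lies below `C`, which gives `j < m`.
    set j := ⌈(G t' x + C) / δ⌉₊
    have hup : δ * j < G t' x + C + δ := by
      have := mul_lt_mul_of_pos_left hceil hδpos
      rw [mul_add, mul_div_cancel₀ _ hδpos.ne'] at this
      linarith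
    have hlo : G t' x + C ≤ δ * j := by
      have := mul_le_mul_of_nonneg_left hceil' hδ0
      rwa [mul_div_cancel₀ _ hδpos.ne'] at this
    have hjm : j < m := by
      have h3 : δ * j < δ * m := by
        rw [hδ, div_mul_cancel₀ _ hm'.ne', ← hδ]
        linarith
      exact_mod_cast lt_of_mul_lt_mul_left h3 hδ0
    have hmem : ((⟨x, hx⟩, ⟨j, hjm⟩) : P × Fin m) ∈ pat t := by
      refine mem_levelPattern.2 ?_
      change -C + δ * j < G t x
      linarith
    rw [h] at hmem
    have h4 : -C + δ * j < G t' x := mem_levelPattern.1 hmem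
    linarith
  let 𝒜 : Finset (Finset (P × Fin m)) := Finset.univ.filter fun a => ∃ t, pat t = a
  have h𝒜 : ∀ a ∈ 𝒜, ∃ t, pat t = a := fun a ha => (Finset.mem_filter.1 ha).2
  have hcard : 𝒜.card ≤ (n * m + 1) ^ d := by
    have hvc : 𝒜.vcDim ≤ d := by
      refine Finset.sup_le fun s hs => ?_
      exact card_le_of_shatters_levelPattern hd P hc h𝒜 (Finset.mem_shatterer.1 hs)
    calc 𝒜.card ≤ 𝒜.shatterer.card := 𝒜.card_le_card_shatterer
      _ ≤ _ := Finset.card_shatterer_le_sum_vcDim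
      _ ≤ _ := sum_choose_le_succ_pow _ _
      _ ≤ (Fintype.card (P × Fin m) + 1) ^ d := Nat.pow_le_pow_right (Nat.succ_pos _) hvc
      _ ≤ (n * m + 1) ^ d := by
        refine Nat.pow_le_pow_left (Nat.succ_le_succ ?_) d
        rw [Fintype.card_prod, Fintype.card_coe, Fintype.card_fin]
        exact Nat.mul_le_mul_right m hn
  have hch : ∀ a : Finset (P × Fin m), ∃ t, a ∈ 𝒜 → pat t = a := by
    intro a
    by_cases ha : a ∈ 𝒜
    · obtain ⟨t, ht⟩ := h𝒜 a ha
      exact ⟨t, fun _ => ht⟩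
    · exact ⟨hT.some, fun h => absurd h ha⟩
  choose rep hrep using hch
  refine ⟨𝒜.image rep, Finset.card_image_le.trans hcard, fun t => ?_⟩
  have hmem : pat t ∈ 𝒜 := Finset.mem_filter.2 ⟨Finset.mem_univ _, t, rfl⟩
  refine ⟨rep (pat t), Finset.mem_image_of_mem rep hmem, fun x hx => ?_⟩
  have heq := hrep _ hmem
  rw [abs_le]
  constructor
  · linarith [hle _ _ heq x hx]
  · linarith [hle _ _ heq.symm x hx]

end Nets

/-! ### A uniform law of large numbers -/

section Rademacher

variable {ι : Type*} [Fintype ι] [DecidableEq ι] {T : Type*}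

/-- The sign attached to a Boolean. -/
def boolSign (b : Bool) : ℝ := if b then 1 else -1

/-- The moment generating function of a Rademacher sum. -/
theorem sum_exp_boolSign_le (a : ι → ℝ) {b : ℝ} (ha : ∀ i, |a i| ≤ b) (θ : ℝ) :
    ∑ σ : ι → Bool, Real.exp (θ * ∑ i, boolSign (σ i) * a i)
      ≤ 2 ^ Fintype.card ι * Real.exp (θ ^ 2 * b ^ 2 * Fintype.card ι / 2) := by
  have h1 : ∑ σ : ι → Bool, Real.exp (θ * ∑ i, boolSign (σ i) * a i)
      = ∏ i, ∑ c : Bool, Real.exp (θ * (boolSign c * a i)) := by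
    rw [Finset.prod_univ_sum, Fintype.piFinset_univ]
    refine Finset.sum_congr rfl fun σ _ => ?_
    rw [Finset.mul_sum, Real.exp_sum]
  have h2 : ∀ i, ∑ c : Bool, Real.exp (θ * (boolSign c * a i))
      ≤ 2 * Real.exp (θ ^ 2 * b ^ 2 / 2) := by
    intro i
    have h3 : ∑ c : Bool, Real.exp (θ * (boolSign c * a i)) = 2 * Real.cosh (θ * a i) := by
      rw [Fintype.sum_bool, Real.cosh_eq]
      simp only [boolSign, if_true, Bool.false_eq_true, if_false]
      ring_nf
    rw [h3]
    have h4 : (θ * a i) ^ 2 ≤ θ ^ 2 * b ^ 2 := by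
      rw [mul_pow]
      exact mul_le_mul_of_nonneg_left (sq_le_sq' (abs_le.1 (ha i)).1 (abs_le.1 (ha i)).2)
        (sq_nonneg θ)
    have h5 := Real.cosh_le_exp_half_sq (θ * a i)
    have h6 : Real.exp ((θ * a i) ^ 2 / 2) ≤ Real.exp (θ ^ 2 * b ^ 2 / 2) :=
      Real.exp_le_exp.2 (by linarith)
    linarith
  rw [h1]
  calc ∏ i, ∑ c : Bool, Real.exp (θ * (boolSign c * a i))
      ≤ ∏ _i : ι, 2 * Real.exp (θ ^ 2 * b ^ 2 / 2) :=
        Finset.prod_le_prod (fun i _ => Finset.sum_nonneg fun _ _ => (Real.exp_pos _).le)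
          fun i _ => h2 i
    _ = _ := by
      rw [Finset.prod_const, Finset.card_univ, mul_pow, ← Real.exp_nat_mul]
      ring_nf

/-- Massart's finite class lemma, in the form of a bound on the sum over all sign vectors. -/
theorem sum_le_of_le_abs_rademacher {S : Finset T} (a : T → ι → ℝ) {b : ℝ}
    (ha : ∀ t i, |a t i| ≤ b) {θ : ℝ} (hθ : 0 < θ) {m : ℝ} (hm : 0 < m) (hS : (S.card : ℝ) ≤ m)
    {Y : (ι → Bool) → ℝ} (hY : ∀ σ, ∃ t ∈ S, Y σ ≤ |∑ i, boolSign (σ i) * a t i|) :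
    ∑ σ, Y σ ≤ 2 ^ Fintype.card ι *
      ((Real.log (2 * m) + θ ^ 2 * b ^ 2 * Fintype.card ι / 2) / θ) := by
  set n := Fintype.card ι
  set e := θ ^ 2 * b ^ 2 * n / 2 with he
  -- Chosen so that `exp c` bounds the sign average of the exponential sum in `h1`, the factor 2
  -- counting both signs of the absolute value. The tangent line of `exp` at `c` then replaces
  -- Jensen's inequality.
  set c := Real.log (2 * m) + e with hc
  have hexp : Real.exp c = 2 * m * Real.exp e := by
    rw [hc, Real.exp_add, Real.exp_log (by linarith)]
  have h1 : ∀ σ, θ * Y σ ≤ c - 1 + Real.exp (-c) *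
      ∑ t ∈ S, (Real.exp (θ * ∑ i, boolSign (σ i) * a t i)
        + Real.exp (-θ * ∑ i, boolSign (σ i) * a t i)) := by
    intro σ
    obtain ⟨t, ht, hYt⟩ := hY σ
    set x := ∑ i, boolSign (σ i) * a t i
    have h2 : Real.exp (θ * Y σ) ≤ Real.exp (θ * x) + Real.exp (-θ * x) := by
      have h3 : θ * Y σ ≤ θ * |x| := mul_le_mul_of_nonneg_left hYt hθ.le
      rcases abs_cases x with ⟨hx, -⟩ | ⟨hx, -⟩
      · rw [hx] at h3
        linarith [Real.exp_le_exp.2 h3, Real.exp_pos (-θ * x)]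
      · rw [hx, mul_neg, ← neg_mul] at h3
        linarith [Real.exp_le_exp.2 h3, Real.exp_pos (θ * x)]
    have h4 : Real.exp (θ * x) + Real.exp (-θ * x) ≤
        ∑ t ∈ S, (Real.exp (θ * ∑ i, boolSign (σ i) * a t i)
        + Real.exp (-θ * ∑ i, boolSign (σ i) * a t i)) :=
      Finset.single_le_sum (f := fun t => Real.exp (θ * ∑ i, boolSign (σ i) * a t i)
        + Real.exp (-θ * ∑ i, boolSign (σ i) * a t i)) (fun t _ => by positivity) ht
    have h5 := Real.add_one_le_exp (θ * Y σ - c)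
    have h6 : Real.exp (θ * Y σ - c) = Real.exp (-c) * Real.exp (θ * Y σ) := by
      rw [← Real.exp_add]; ring_nf
    have h7 := mul_le_mul_of_nonneg_left (h2.trans h4) (Real.exp_pos (-c)).le
    linarith
  have h8 : ∑ σ : ι → Bool, ∑ t ∈ S, (Real.exp (θ * ∑ i, boolSign (σ i) * a t i)
        + Real.exp (-θ * ∑ i, boolSign (σ i) * a t i)) ≤ 2 ^ n * Real.exp c := by
    rw [Finset.sum_comm]
    calc ∑ t ∈ S, ∑ σ : ι → Bool, (Real.exp (θ * ∑ i, boolSign (σ i) * a t i)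
          + Real.exp (-θ * ∑ i, boolSign (σ i) * a t i))
        ≤ ∑ t ∈ S, 2 * (2 ^ n * Real.exp e) := by
          refine Finset.sum_le_sum fun t _ => ?_
          rw [Finset.sum_add_distrib]
          have h9 := sum_exp_boolSign_le (a t) (ha t) θ
          have h10 := sum_exp_boolSign_le (a t) (ha t) (-θ)
          rw [neg_sq] at h10
          linarith
      _ = S.card * (2 * (2 ^ n * Real.exp e)) := by rw [Finset.sum_const, nsmul_eq_mul]
      _ ≤ m * (2 * (2 ^ n * Real.exp e)) := mul_le_mul_of_nonneg_right hS (by positivity)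
      _ = 2 ^ n * Real.exp c := by rw [hexp]; ring
  have h11 : θ * ∑ σ, Y σ ≤ 2 ^ n * c := by
    rw [Finset.mul_sum]
    refine (Finset.sum_le_sum fun σ _ => h1 σ).trans ?_
    rw [Finset.sum_add_distrib, ← Finset.mul_sum, Finset.sum_const, Finset.card_univ,
      Fintype.card_fun, Fintype.card_bool, nsmul_eq_mul]
    have h12 := mul_le_mul_of_nonneg_left h8 (Real.exp_pos (-c)).le
    have h13 : Real.exp (-c) * (2 ^ n * Real.exp c) = 2 ^ n := by
      rw [mul_left_comm, ← Real.exp_add]; simp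
    rw [h13] at h12
    push_cast
    linarith
  rw [← mul_div_assoc, le_div_iff₀ hθ]
  linarith

/-- Rademacher sums over a class with a finite net at scale `ε`. -/
theorem sum_iSup_rademacher_le [Nonempty T] (a : T → ι → ℝ) {b : ℝ} (ha : ∀ t i, |a t i| ≤ b)
    {θ : ℝ} (hθ : 0 < θ) {m : ℝ} {ε : ℝ} {S : Finset T} (hS : (S.card : ℝ) ≤ m)
    (hnet : ∀ t, ∃ t' ∈ S, ∀ i, |a t i - a t' i| ≤ ε) :
    ∑ σ : ι → Bool, ⨆ t, ‖∑ i, boolSign (σ i) * a t i‖ₑ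
      ≤ 2 ^ Fintype.card ι * ENNReal.ofReal (Fintype.card ι * ε
        + (Real.log (2 * m) + θ ^ 2 * b ^ 2 * Fintype.card ι / 2) / θ) := by
  set n := Fintype.card ι
  have hSne : S.Nonempty := by
    obtain ⟨t', ht', -⟩ := hnet (Classical.arbitrary T)
    exact ⟨t', ht'⟩
  have hm : 0 < m := lt_of_lt_of_le (by exact_mod_cast hSne.card_pos) hS
  let Y : (ι → Bool) → ℝ := fun σ => S.sup' hSne fun t => |∑ i, boolSign (σ i) * a t i|
  have hY : ∀ σ, ∃ t ∈ S, Y σ ≤ |∑ i, boolSign (σ i) * a t i| := by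
    intro σ
    obtain ⟨t, ht, h⟩ := Finset.exists_mem_eq_sup' hSne
      fun t => |∑ i, boolSign (σ i) * a t i|
    exact ⟨t, ht, h.le⟩
  have hsum := sum_le_of_le_abs_rademacher a ha hθ hm hS hY
  have hY0 : ∀ σ, 0 ≤ Y σ := fun σ => by
    obtain ⟨t, ht⟩ := hSne
    exact (abs_nonneg _).trans
      (Finset.le_sup' (fun t => |∑ i, boolSign (σ i) * a t i|) ht)
  have hsign : ∀ b, |boolSign b| = 1 := by
    intro b; cases b <;> simp [boolSign]
  have hle : ∀ σ t, |∑ i, boolSign (σ i) * a t i| ≤ n * ε + Y σ := by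
    intro σ t
    obtain ⟨t', ht', hd⟩ := hnet t
    have h1 : ∑ i, boolSign (σ i) * a t i = ∑ i, boolSign (σ i) * (a t i - a t' i)
        + ∑ i, boolSign (σ i) * a t' i := by
      rw [← Finset.sum_add_distrib]
      exact Finset.sum_congr rfl fun i _ => by ring
    rw [h1]
    refine (abs_add_le _ _).trans (add_le_add ?_ ?_)
    · refine (Finset.abs_sum_le_sum_abs _ _).trans ?_
      calc ∑ i, |boolSign (σ i) * (a t i - a t' i)| ≤ ∑ _i : ι, ε :=
            Finset.sum_le_sum fun i _ => by rw [abs_mul, hsign, one_mul]; exact hd i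
        _ = n * ε := by rw [Finset.sum_const, Finset.card_univ, nsmul_eq_mul]
    · exact Finset.le_sup' (fun t => |∑ i, boolSign (σ i) * a t i|) ht'
  have hnn : ∀ σ, 0 ≤ n * ε + Y σ := fun σ =>
    (abs_nonneg _).trans (hle σ (Classical.arbitrary T))
  calc ∑ σ : ι → Bool, ⨆ t, ‖∑ i, boolSign (σ i) * a t i‖ₑ
      ≤ ∑ σ : ι → Bool, ENNReal.ofReal (n * ε + Y σ) := by
        refine Finset.sum_le_sum fun σ _ => iSup_le fun t => ?_
        rw [Real.enorm_eq_ofReal_abs]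
        exact ENNReal.ofReal_le_ofReal (hle σ t)
    _ = ENNReal.ofReal (∑ σ, (n * ε + Y σ)) :=
        (ENNReal.ofReal_sum_of_nonneg fun σ _ => hnn σ).symm
    _ ≤ ENNReal.ofReal (2 ^ n * (n * ε
          + (Real.log (2 * m) + θ ^ 2 * b ^ 2 * n / 2) / θ)) := by
        refine ENNReal.ofReal_le_ofReal ?_
        rw [Finset.sum_add_distrib, Finset.sum_const, Finset.card_univ, Fintype.card_fun,
          Fintype.card_bool, nsmul_eq_mul, mul_add]
        push_cast
        linarith
    _ = _ := by
        rw [ENNReal.ofReal_mul (by positivity), ENNReal.ofReal_pow (by norm_num),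
          ENNReal.ofReal_ofNat]

end Rademacher

/-! ### Symmetrization with a ghost sample. -/

section Symmetrization

variable {ι : Type*} [Fintype ι] [DecidableEq ι] {T : Type*} [MeasurableSpace T] [StandardBorelSpace T]
  {E : Type*} [MeasurableSpace E]

/-- Symmetrization of the deviation between two independent samples. -/
theorem lintegral_iSup_sum_sub_le [Nonempty T] (P : Measure E) [IsProbabilityMeasure P]
    {g : T → E → ℝ} (hg : Measurable (Function.uncurry g)) {b : ENNReal}
    (hb : ∀ z : ι → E, ∑ σ : ι → Bool, ⨆ t, ‖∑ i, boolSign (σ i) * g t (z i)‖ₑ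
      ≤ 2 ^ Fintype.card ι * b) :
    AEMeasurable (fun q : (ι → E) × (ι → E) => ⨆ t, ‖∑ i, (g t (q.1 i) - g t (q.2 i))‖ₑ)
      ((Measure.pi fun _ : ι => P).prod (Measure.pi fun _ : ι => P)) ∧
    ∫⁻ z, ∫⁻ z', ⨆ t, ‖∑ i, (g t (z i) - g t (z' i))‖ₑ ∂(Measure.pi fun _ : ι => P)
      ∂(Measure.pi fun _ : ι => P) ≤ 2 * b := by
  set π : Measure (ι → E) := Measure.pi fun _ : ι => P with hπ
  let ρ : Measure (ι → E × E) := Measure.pi fun _ : ι => P.prod P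
  have hW : AEMeasurable (fun q : (ι → E) × (ι → E) =>
      ⨆ t, ‖∑ i, (g t (q.1 i) - g t (q.2 i))‖ₑ) (π.prod π) := by
    refine aemeasurable_iSup_of_standardBorel (π.prod π)
      (g := fun p : T × ((ι → E) × (ι → E)) =>
        ‖∑ i, (g p.1 (p.2.1 i) - g p.1 (p.2.2 i))‖ₑ) ?_
    refine Measurable.enorm (Finset.measurable_fun_sum _ fun i _ => ?_)
    exact (hg.comp (by fun_prop : Measurable fun p : T × ((ι → E) × (ι → E)) => (p.1, p.2.1 i))).sub
      (hg.comp (by fun_prop : Measurable fun p : T × ((ι → E) × (ι → E)) => (p.1, p.2.2 i)))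
  refine ⟨hW, ?_⟩
  have hV : ∀ σ : ι → Bool, AEMeasurable (fun w : ι → E × E =>
      ⨆ t, ‖∑ i, boolSign (σ i) * (g t (w i).1 - g t (w i).2)‖ₑ) ρ := by
    intro σ
    refine aemeasurable_iSup_of_standardBorel ρ (g := fun p : T × (ι → E × E) =>
        ‖∑ i, boolSign (σ i) * (g p.1 (p.2 i).1 - g p.1 (p.2 i).2)‖ₑ) ?_
    refine Measurable.enorm (Finset.measurable_fun_sum _ fun i _ => Measurable.const_mul ?_ _)
    exact (hg.comp (by fun_prop : Measurable fun p : T × (ι → E × E) => (p.1, (p.2 i).1))).sub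
      (hg.comp (by fun_prop : Measurable fun p : T × (ι → E × E) => (p.1, (p.2 i).2)))
  set V : (ι → Bool) → (ι → E × E) → ENNReal := fun σ w =>
      ⨆ t, ‖∑ i, boolSign (σ i) * (g t (w i).1 - g t (w i).2)‖ₑ with hVdef
  have hVtrue : ∀ w : ι → E × E, V (fun _ => true) w
      = ⨆ t, ‖∑ i, (g t (w i).1 - g t (w i).2)‖ₑ := by
    intro w
    simp [hVdef, boolSign]
  -- Exchanging the two entries of the `i`-th pair flips the sign of the `i`-th summand and
  -- preserves the law, so all sign patterns have the same integral.
  have hswap : ∀ σ, ∫⁻ w, V σ w ∂ρ = ∫⁻ w, V (fun _ => true) w ∂ρ := by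
    intro σ
    have hmp : MeasurePreserving
        (fun (w : ι → E × E) i => (if σ i then (id : E × E → E × E) else Prod.swap) (w i)) ρ ρ := by
      refine measurePreserving_pi _ _ fun i => ?_
      split_ifs
      · exact MeasurePreserving.id _
      · exact Measure.measurePreserving_swap
    have h1 := hV fun _ => true
    rw [← hmp.map_eq] at h1
    have h2 := lintegral_map' h1 hmp.measurable.aemeasurable
    rw [hmp.map_eq] at h2
    rw [h2]
    refine lintegral_congr fun w => iSup_congr fun t => ?_
    congr 1
    refine Finset.sum_congr rfl fun i _ => ?_
    rcases h : σ i <;> simp [boolSign, h]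
  have hbound : ∀ w : ι → E × E, ∑ σ, V σ w ≤ 2 ^ Fintype.card ι * (2 * b) := by
    intro w
    have h1 : ∀ σ, V σ w ≤ (⨆ t, ‖∑ i, boolSign (σ i) * g t (w i).1‖ₑ)
        + ⨆ t, ‖∑ i, boolSign (σ i) * g t (w i).2‖ₑ := by
      intro σ
      refine iSup_le fun t => ?_
      have h2 : ∑ i, boolSign (σ i) * (g t (w i).1 - g t (w i).2)
          = ∑ i, boolSign (σ i) * g t (w i).1 - ∑ i, boolSign (σ i) * g t (w i).2 := by
        rw [← Finset.sum_sub_distrib]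
        exact Finset.sum_congr rfl fun i _ => by ring
      rw [h2]
      exact enorm_sub_le.trans (add_le_add
        (le_iSup (fun t => ‖∑ i, boolSign (σ i) * g t (w i).1‖ₑ) t)
        (le_iSup (fun t => ‖∑ i, boolSign (σ i) * g t (w i).2‖ₑ) t))
    refine (Finset.sum_le_sum fun σ _ => h1 σ).trans ?_
    rw [Finset.sum_add_distrib, two_mul, mul_add]
    exact add_le_add (hb fun i => (w i).1) (hb fun i => (w i).2)
  have hρ : (2 : ENNReal) ^ Fintype.card ι * ∫⁻ w, V (fun _ => true) w ∂ρ
      ≤ 2 ^ Fintype.card ι * (2 * b) := by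
    calc (2 : ENNReal) ^ Fintype.card ι * ∫⁻ w, V (fun _ => true) w ∂ρ
        = ∑ σ : ι → Bool, ∫⁻ w, V σ w ∂ρ := by
          rw [Finset.sum_congr rfl fun σ _ => hswap σ, Finset.sum_const, Finset.card_univ,
            Fintype.card_fun, Fintype.card_bool, nsmul_eq_mul]
          norm_num
      _ = ∫⁻ w, ∑ σ : ι → Bool, V σ w ∂ρ := (lintegral_finsetSum' _ fun σ _ => hV σ).symm
      _ ≤ ∫⁻ _, 2 ^ Fintype.card ι * (2 * b) ∂ρ := lintegral_mono hbound
      _ = 2 ^ Fintype.card ι * (2 * b) := by simp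
  have hρ' := (ENNReal.mul_le_mul_iff_right (by positivity) (by finiteness)).1 hρ
  refine le_trans (le_of_eq ?_) hρ'
  rw [← lintegral_prod (fun q : (ι → E) × (ι → E) =>
      ⨆ t, ‖∑ i, (g t (q.1 i) - g t (q.2 i))‖ₑ) hW]
  -- A pair of samples is regrouped as one sample of pairs.
  have hmp := measurePreserving_arrowProdEquivProdArrow E E ι (fun _ => P) (fun _ => P)
  have hW' := hW
  rw [← hmp.map_eq] at hW'
  have h1 := lintegral_map' hW' hmp.measurable.aemeasurable
  rw [hmp.map_eq] at h1
  rw [h1]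
  refine lintegral_congr fun w => ?_
  rw [hVtrue]
  rfl

end Symmetrization

/-! ### Expected uniform deviation of empirical means. -/

section UniformLaw

variable {T : Type*} [MeasurableSpace T] [StandardBorelSpace T] [Nonempty T]
  {E : Type*} [MeasurableSpace E] {N : ℕ}

/-- The deviation of an empirical mean is bounded by the mean deviation from a ghost sample. -/
theorem enorm_sum_sub_le_lintegral (P : Measure E) [IsProbabilityMeasure P] {f : E → ℝ}
    (hf : Measurable f) {b : ℝ} (hb : ∀ e, |f e| ≤ b) (z : Fin N → E) :
    ‖∑ i, f (z i) - N * ∫ e, f e ∂P‖ₑ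
      ≤ ∫⁻ z' : Fin N → E, ‖∑ i, (f (z i) - f (z' i))‖ₑ ∂(Measure.pi fun _ => P) := by
  have hint : ∀ i : Fin N, Integrable (fun z' : Fin N → E => f (z' i))
      (Measure.pi fun _ => P) := fun i =>
    Integrable.of_bound (hf.comp (measurable_pi_apply i)).aestronglyMeasurable b
      (Filter.Eventually.of_forall fun z' => hb _)
  have hval : ∀ i : Fin N, ∫ z' : Fin N → E, f (z' i) ∂(Measure.pi fun _ => P)
      = ∫ e, f e ∂P := by
    intro i
    have hmp := measurePreserving_eval (fun _ : Fin N => P) i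
    have h := integral_map hmp.measurable.aemeasurable
      (f := f) (by rw [hmp.map_eq]; exact hf.aestronglyMeasurable)
    rw [hmp.map_eq] at h
    exact h.symm
  -- The expectation is written as an average over the ghost sample; the norm then moves inside the
  -- integral.
  have heq : ∑ i, f (z i) - N * ∫ e, f e ∂P
      = ∫ z' : Fin N → E, ∑ i, (f (z i) - f (z' i)) ∂(Measure.pi fun _ => P) := by
    rw [integral_finsetSum (f := fun i (z' : Fin N → E) => f (z i) - f (z' i)) _
      fun i _ => (integrable_const _).sub (hint i)]
    rw [Finset.sum_congr rfl fun i _ => integral_sub (integrable_const _) (hint i)]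
    simp_rw [hval]
    simp
  rw [heq]
  exact enorm_integral_le_lintegral_enorm _

/-- Uniform law of large numbers for a measurably parametrized bounded class with finite nets. -/
theorem exists_uniform_deviation_bound (P : Measure E) [IsProbabilityMeasure P]
    {g : T → E → ℝ} (hg : Measurable (Function.uncurry g)) {b : ℝ} (hb : ∀ t e, |g t e| ≤ b)
    (hN : 2 ≤ N) {m ε k : ℝ}
    (hnet : ∀ z : Fin N → E, ∃ S : Finset T, (S.card : ℝ) ≤ m ∧
      ∀ t, ∃ t' ∈ S, ∀ i, |g t (z i) - g t' (z i)| ≤ ε)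
    (hm : Real.log (2 * m) ≤ k * Real.log N)
    {Ξ : Type*} [MeasurableSpace Ξ] (Q : Measure Ξ) [IsProbabilityMeasure Q]
    {Z : Fin N → Ξ → E} (hZ : ∀ i, Measurable (Z i)) (hind : iIndepFun Z Q)
    (hlaw : ∀ i, Q.map (Z i) = P) :
    ∃ h : Ξ → ℝ, Integrable h Q ∧
      (∀ ξ t, |(∑ i, g t (Z i ξ)) / N - ∫ e, g t e ∂P| ≤ h ξ) ∧
      ∫ ξ, h ξ ∂Q ≤ 2 * (ε + (k + b ^ 2 / 2) * Real.sqrt (Real.log N / N)) := by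
  have hN0 : (0 : ℝ) < N := by exact_mod_cast (by omega : 0 < N)
  have hlog : 0 < Real.log N := Real.log_pos (by exact_mod_cast (by omega : 1 < N))
  -- Balances Massart's bound: since `log (2 m) ≤ k log N`, after division by `N` its two terms are
  -- at most `k θ` and `b² θ / 2`.
  set θ := Real.sqrt (Real.log N / N) with hθdef
  have hθ : 0 < θ := Real.sqrt_pos.2 (div_pos hlog hN0)
  have hθ2 : θ * θ = Real.log N / N := Real.mul_self_sqrt (div_pos hlog hN0).le
  set β := N * ε + (Real.log (2 * m) + θ ^ 2 * b ^ 2 * N / 2) / θ with hβ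
  have hsym := lintegral_iSup_sum_sub_le (ι := Fin N) P hg (b := ENNReal.ofReal β) (by
    intro z
    obtain ⟨S, hS, hSnet⟩ := hnet z
    have := sum_iSup_rademacher_le (fun t i => g t (z i)) (fun t i => hb t (z i)) hθ hS hSnet
    simpa [hβ] using this)
  obtain ⟨hWm, hWle⟩ := hsym
  set π : Measure (Fin N → E) := Measure.pi fun _ => P with hπ
  have hmap : Q.map (fun ξ i => Z i ξ) = π := by
    rw [(iIndepFun_iff_map_fun_eq_pi_map fun i => (hZ i).aemeasurable).1 hind]
    simp_rw [hlaw]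
    rfl
  have hZm : Measurable fun ξ i => Z i ξ := measurable_pi_lambda _ hZ
  -- By Fubini this is an almost everywhere measurable majorant of `N` times the uniform deviation;
  -- dividing it by `N` gives the witness `h`.
  let D : (Fin N → E) → ENNReal := fun z => ∫⁻ z', ⨆ t, ‖∑ i, (g t (z i) - g t (z' i))‖ₑ ∂π
  have hDm : AEMeasurable D π := hWm.lintegral_prod_right'
  have hb0 : 0 ≤ b := by
    have : Nonempty E := nonempty_of_isProbabilityMeasure P
    exact (abs_nonneg _).trans (hb (Classical.arbitrary T) (Classical.arbitrary E))
  have hDfin : ∀ z, D z < ⊤ := by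
    intro z
    have h1 : D z ≤ ∫⁻ _, ENNReal.ofReal (N * (2 * b)) ∂π := by
      refine lintegral_mono fun z' => iSup_le fun t => ?_
      rw [Real.enorm_eq_ofReal_abs]
      refine ENNReal.ofReal_le_ofReal ((Finset.abs_sum_le_sum_abs _ _).trans ?_)
      calc ∑ i, |g t (z i) - g t (z' i)| ≤ ∑ _i : Fin N, 2 * b :=
            Finset.sum_le_sum fun i _ => (abs_sub _ _).trans (by
              linarith [hb t (z i), hb t (z' i)])
        _ = N * (2 * b) := by simp
    refine h1.trans_lt ?_
    rw [lintegral_const, measure_univ, mul_one]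
    exact ENNReal.ofReal_lt_top
  rw [← hmap] at hDm
  have hDQ : AEMeasurable (fun ξ => D fun i => Z i ξ) Q := hDm.comp_measurable hZm
  have hDint : ∫⁻ ξ, D (fun i => Z i ξ) ∂Q ≤ 2 * ENNReal.ofReal β := by
    have h1 := lintegral_map' hDm hZm.aemeasurable
    rw [← h1, hmap]
    exact hWle
  have hne : ∫⁻ ξ, D (fun i => Z i ξ) ∂Q ≠ ⊤ := ne_top_of_le_ne_top (by finiteness) hDint
  have hi : Integrable (fun ξ => (D fun i => Z i ξ).toReal) Q :=
    integrable_toReal_of_lintegral_ne_top hDQ hne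
  refine ⟨fun ξ => (D fun i => Z i ξ).toReal / N, hi.div_const _, ?_, ?_⟩
  · intro ξ t
    rw [le_div_iff₀ hN0]
    have h1 : |(∑ i, g t (Z i ξ)) / N - ∫ e, g t e ∂P| * N
        = |∑ i, g t (Z i ξ) - N * ∫ e, g t e ∂P| := by
      rw [← abs_of_pos hN0, ← abs_mul, abs_of_pos hN0, sub_mul, div_mul_cancel₀ _ hN0.ne',
        mul_comm (N : ℝ)]
    rw [h1, ← ENNReal.ofReal_le_iff_le_toReal (hDfin _).ne, ← Real.enorm_eq_ofReal_abs]
    refine (enorm_sum_sub_le_lintegral P (hg.comp measurable_prodMk_left) (hb t)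
      fun i => Z i ξ).trans ?_
    exact lintegral_mono fun z' => le_iSup (fun t => ‖∑ i, (g t (Z i ξ) - g t (z' i))‖ₑ) t
  · rw [integral_div, integral_toReal hDQ (Filter.Eventually.of_forall fun ξ => hDfin _),
      div_le_iff₀ hN0]
    have h1 : (∫⁻ ξ, D (fun i => Z i ξ) ∂Q).toReal ≤ 2 * max β 0 := by
      refine ENNReal.toReal_le_of_le_ofReal (by positivity) ?_
      rw [ENNReal.ofReal_mul (by norm_num), ENNReal.ofReal_ofNat]
      refine hDint.trans ?_
      gcongr
      exact le_max_left _ _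
    have hε : 0 ≤ ε := by
      obtain ⟨S, -, hSn⟩ := hnet fun _ => (nonempty_of_isProbabilityMeasure P).some
      obtain ⟨t', -, h⟩ := hSn (Classical.arbitrary T)
      exact (abs_nonneg _).trans (h ⟨0, by omega⟩)
    have hm1 : 0 ≤ Real.log (2 * m) := by
      obtain ⟨S, hS, hSn⟩ := hnet fun _ => (nonempty_of_isProbabilityMeasure P).some
      obtain ⟨t', ht', -⟩ := hSn (Classical.arbitrary T)
      have : (1 : ℝ) ≤ S.card := by exact_mod_cast Finset.card_pos.2 ⟨t', ht'⟩
      exact Real.log_nonneg (by linarith)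
    have hβpos : 0 ≤ β := by positivity
    rw [max_eq_left hβpos] at h1
    refine h1.trans ?_
    have h2 : β ≤ N * ε + (k * Real.log N + θ ^ 2 * b ^ 2 * N / 2) / θ := by
      rw [hβ]; gcongr
    have h3 : (k * Real.log N + θ ^ 2 * b ^ 2 * N / 2) / θ = (k + b ^ 2 / 2) * θ * N := by
      have h4 : Real.log N = θ * θ * N := by rw [hθ2]; field_simp
      rw [h4]
      field_simp
    rw [h3] at h2
    nlinarith

end UniformLaw

/-! ### The conjugate on a bounded interval -/

section Conj

variable {φ : ℝ → ℝ} {C : ℝ} {κ : NNReal}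

theorem abs_conj_sub_le (hκ : LipschitzOnWith κ (conj φ) (Icc (-C) C)) {x y : ℝ} (hx : |x| ≤ C)
    (hy : |y| ≤ C) : |conj φ x - conj φ y| ≤ κ * |x - y| := by
  have h := hκ.dist_le_mul x (abs_le.1 hx) y (abs_le.1 hy)
  rwa [Real.dist_eq, Real.dist_eq] at h

theorem abs_conj_le (hκ : LipschitzOnWith κ (conj φ) (Icc (-C) C)) {x : ℝ} (hx : |x| ≤ C) :
    |conj φ x| ≤ |conj φ 0| + κ * C := by
  have h := abs_conj_sub_le hκ hx (y := 0) (by simpa using (abs_nonneg x).trans hx)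
  rw [sub_zero] at h
  have h2 := abs_sub_abs_le_abs_sub (conj φ x) (conj φ 0)
  have h3 : (κ : ℝ) * |x| ≤ κ * C := mul_le_mul_of_nonneg_left hx κ.2
  linarith

/-- Outside `[-C, C]` the supremum defining `conj φ` may be infinite, where `sSup` returns 0. A
Lipschitz extension provides a Borel function that agrees with it where it is used. -/
theorem exists_measurable_eq_conj (hκ : LipschitzOnWith κ (conj φ) (Icc (-C) C)) :
    ∃ ψ : ℝ → ℝ, Measurable ψ ∧ ∀ x, |x| ≤ C → conj φ x = ψ x := by
  obtain ⟨ψ, hψ, heq⟩ := hκ.extend_real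
  exact ⟨ψ, hψ.continuous.measurable, fun x hx => heq (abs_le.1 hx)⟩

end Conj

/-! ### Suprema of concave quadratic saddle functions -/

section DualValue

variable {Y : Type*}

/-- The value `sup_{f ∈ 𝓕, u ∈ ℝ} A f + λ (u (a - 1) - u² / 2)`. -/
def dualValue (lam : ℝ) (𝓕 : Set Y) (A : Y → ℝ) (a : ℝ) : ℝ :=
  sSup ((fun q : Y × ℝ => A q.1 + lam * (q.2 * (a - 1) - q.2 ^ 2 / 2)) '' (𝓕 ×ˢ univ))

variable {lam : ℝ} {𝓕 : Set Y} {A : Y → ℝ} {a b : ℝ}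

/-- Completing the square: the maximum over `u` is attained at `u = a - 1`. -/
theorem quadratic_le (hlam : 0 < lam) (u a : ℝ) :
    lam * (u * (a - 1) - u ^ 2 / 2) ≤ lam * ((a - 1) ^ 2 / 2) :=
  mul_le_mul_of_nonneg_left (by nlinarith [sq_nonneg (u - (a - 1))]) hlam.le

theorem bddAbove_dualValue (hlam : 0 < lam) (hA : ∀ f ∈ 𝓕, A f ≤ b) :
    BddAbove ((fun q : Y × ℝ => A q.1 + lam * (q.2 * (a - 1) - q.2 ^ 2 / 2)) '' (𝓕 ×ˢ univ)) := by
  refine ⟨b + lam * ((a - 1) ^ 2 / 2), ?_⟩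
  rintro _ ⟨⟨f, u⟩, ⟨hf, -⟩, rfl⟩
  exact add_le_add (hA f hf) (quadratic_le hlam u a)

theorem le_dualValue (hlam : 0 < lam) (hA : ∀ f ∈ 𝓕, A f ≤ b) {f : Y} (hf : f ∈ 𝓕) (u : ℝ) :
    A f + lam * (u * (a - 1) - u ^ 2 / 2) ≤ dualValue lam 𝓕 A a :=
  le_csSup (bddAbove_dualValue hlam hA) ⟨(f, u), ⟨hf, mem_univ _⟩, rfl⟩

theorem dualValue_le (hne : 𝓕.Nonempty) {c : ℝ}
    (h : ∀ f ∈ 𝓕, ∀ u, A f + lam * (u * (a - 1) - u ^ 2 / 2) ≤ c) : dualValue lam 𝓕 A a ≤ c := by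
  refine csSup_le ((hne.prod univ_nonempty).image _) ?_
  rintro _ ⟨⟨f, u⟩, ⟨hf, -⟩, rfl⟩
  exact h f hf u

theorem abs_dualValue_le (hlam : 0 < lam) (hne : 𝓕.Nonempty) (hA : ∀ f ∈ 𝓕, |A f| ≤ b) {R : ℝ}
    (ha : |a - 1| ≤ R) : |dualValue lam 𝓕 A a| ≤ b + lam * (R ^ 2 / 2) := by
  have hsq : (a - 1) ^ 2 ≤ R ^ 2 := sq_le_sq' (abs_le.1 ha).1 (abs_le.1 ha).2
  have hR : lam * ((a - 1) ^ 2 / 2) ≤ lam * (R ^ 2 / 2) :=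
    mul_le_mul_of_nonneg_left (by linarith) hlam.le
  rw [abs_le]
  constructor
  · obtain ⟨f, hf⟩ := hne
    have h1 := le_dualValue (a := a) hlam (fun f hf => (abs_le.1 (hA f hf)).2) hf 0
    have h2 := (abs_le.1 (hA f hf)).1
    have h3 : 0 ≤ lam * (R ^ 2 / 2) := by positivity
    simp only [zero_mul] at h1
    norm_num at h1
    linarith
  · refine dualValue_le hne fun f hf u => ?_
    linarith [(abs_le.1 (hA f hf)).2, quadratic_le hlam u a]

/-- Comparison of two saddle values. -/
theorem dualValue_le_dualValue (hlam : 0 < lam) (hne : 𝓕.Nonempty) {𝓖 : Set Y} {A' : Y → ℝ}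
    {a' : ℝ} (hA' : ∀ f ∈ 𝓖, A' f ≤ b) {R c η : ℝ} (ha : |a - 1| ≤ R) (haa : |a - a'| ≤ η)
    (h : ∀ f ∈ 𝓕, ∀ δ > 0, ∃ f' ∈ 𝓖, A f ≤ A' f' + c + δ) :
    dualValue lam 𝓕 A a ≤ dualValue lam 𝓖 A' a' + c + lam * R * η := by
  refine dualValue_le hne fun f hf u => le_of_forall_pos_le_add fun δ hδ => ?_
  obtain ⟨f', hf', hff⟩ := h f hf δ hδ
  -- The maximizer `a - 1` of the left value is tested in the right one. The loss is `lam (a - 1) (a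
  -- - a')`, at most `lam R η`.
  have h1 := le_dualValue (a := a') hlam hA' hf' (a - 1)
  have h2 := quadratic_le hlam u a
  have h3 : (a - 1) * (a - a') ≤ R * η := by
    refine (le_abs_self _).trans ?_
    rw [abs_mul]
    exact mul_le_mul ha haa (abs_nonneg _) ((abs_nonneg _).trans ha)
  have h4 := mul_le_mul_of_nonneg_left h3 hlam.le
  have h5 : lam * ((a - 1) ^ 2 / 2) = lam * ((a - 1) * (a' - 1) - (a - 1) ^ 2 / 2)
      + lam * ((a - 1) * (a - a')) := by ring
  linarith

end DualValue

/-! ### Approximation errors -/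

section Approximation

variable {X : Type*} [MeasurableSpace X] {C : ℝ} {p : Measure X}

theorem integrable_of_abs_le {E : Type*} [MeasurableSpace E] {ρ : Measure E} [IsFiniteMeasure ρ]
    {f : E → ℝ} (hf : Measurable f) {b : ℝ} (hb : ∀ x, |f x| ≤ b) : Integrable f ρ :=
  Integrable.of_bound hf.aestronglyMeasurable b (Filter.Eventually.of_forall hb)

theorem integral_abs_sub_le [IsProbabilityMeasure p] {f g : X → ℝ} (hf : Measurable f)
    (hg : Measurable g) {b : ℝ}
    (hb : ∀ x, |f x - g x| ≤ b) : ∫ x, |f x - g x| ∂p ≤ b := by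
  have h := integral_mono (μ := p) (f := fun x => |f x - g x|) (g := fun _ => b)
    (integrable_of_abs_le (hf.sub hg) hb).abs (integrable_const b) hb
  simpa using h

theorem approxErrorDual_nonneg {F : Set (X → ℝ)} : 0 ≤ approxErrorDual p C F := by
  refine Real.sSup_nonneg ?_
  rintro _ ⟨q, -, rfl⟩
  refine Real.sInf_nonneg ?_
  rintro _ ⟨r, -, rfl⟩
  have : 0 ≤ ∫ x, |q.1 x - r.1 x| ∂p := integral_nonneg fun x => abs_nonneg _
  positivity

theorem approxErrorRatio_nonneg {H : Set (X → ℝ)} : 0 ≤ approxErrorRatio p C H := by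
  refine Real.sSup_nonneg ?_
  rintro _ ⟨q, -, rfl⟩
  refine Real.sInf_nonneg ?_
  rintro _ ⟨r, -, rfl⟩
  exact integral_nonneg fun x => abs_nonneg _

/-- The functional part of the dual approximation error suffices, because `u` is always optimized
over the whole line. It is isolated by taking `u₁ = 0` and dropping the term `|u₂|`; the slack `δ`
is there because the infimum need not be attained. -/
theorem exists_integral_abs_sub_le_dual [IsProbabilityMeasure p] {F : Set (X → ℝ)}
    (hF : F ⊆ dualBall C) (hne : F.Nonempty) (hC : 0 ≤ C) {f : X → ℝ} (hf : f ∈ dualBall C) {δ : ℝ} (hδ : 0 < δ) :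
    ∃ f' ∈ F, ∫ x, |f x - f' x| ∂p ≤ approxErrorDual p C F + δ := by
  let v : (X → ℝ) × ℝ → (X → ℝ) × ℝ → ℝ := fun q r => ∫ x, |q.1 x - r.1 x| ∂p + |q.2 - r.2|
  have hv : ∀ q r, 0 ≤ v q r := fun q r => by
    have : 0 ≤ ∫ x, |q.1 x - r.1 x| ∂p := integral_nonneg fun x => abs_nonneg _
    positivity
  -- Boundedness must be shown, since `sSup` of an unbounded set of reals is 0.
  have hbdd : BddAbove ((fun q => sInf (v q '' (F ×ˢ dualInterval C))) ''
      (dualBall C ×ˢ dualInterval C)) := by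
    refine ⟨2 * C, ?_⟩
    rintro _ ⟨⟨g, u⟩, ⟨hg, hu⟩, rfl⟩
    obtain ⟨f₀, hf₀⟩ := hne
    refine (csInf_le (s := v (g, u) '' (F ×ˢ dualInterval C)) (a := v (g, u) (f₀, u)) ?_
      ⟨(f₀, u), ⟨hf₀, hu⟩, rfl⟩).trans ?_
    · refine ⟨0, ?_⟩
      rintro _ ⟨r, -, rfl⟩
      exact hv _ _
    · have h1 := integral_abs_sub_le (p := p) (b := 2 * C) hg.1 (hF hf₀).1 fun x =>
        (abs_sub _ _).trans (by linarith [hg.2 x, (hF hf₀).2 x])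
      simpa [v] using h1
  have h0 : (0 : ℝ) ∈ dualInterval C := ⟨by linarith, by linarith⟩
  have hle : sInf (v (f, 0) '' (F ×ˢ dualInterval C)) ≤ approxErrorDual p C F :=
    le_csSup hbdd ⟨(f, 0), ⟨hf, h0⟩, rfl⟩
  obtain ⟨_, ⟨⟨f', u'⟩, ⟨hf', -⟩, rfl⟩, hlt⟩ :=
    exists_lt_of_csInf_lt ((hne.prod ⟨0, h0⟩).image _) (hle.trans_lt (lt_add_of_pos_right _ hδ))
  refine ⟨f', hf', ?_⟩
  have h2 : ∫ x, |f x - f' x| ∂p + |0 - u'| < approxErrorDual p C F + δ := hlt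
  linarith [abs_nonneg (0 - u')]

theorem exists_integral_abs_sub_le_ratio [IsProbabilityMeasure p] {H : Set (X → ℝ)}
    (hH : H ⊆ ratioBall C) (hne : H.Nonempty) {τ : X → ℝ} (hτ : τ ∈ ratioBall C) {δ : ℝ} (hδ : 0 < δ) :
    ∃ τ' ∈ H, ∫ x, |τ x - τ' x| ∂p ≤ approxErrorRatio p C H + δ := by
  have hbdd : BddAbove ((fun τ₁ : X → ℝ =>
      sInf ((fun τ₂ : X → ℝ => ∫ x, |τ₁ x - τ₂ x| ∂p) '' H)) '' ratioBall C) := by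
    refine ⟨C, ?_⟩
    rintro _ ⟨g, hg, rfl⟩
    obtain ⟨f₀, hf₀⟩ := hne
    refine (csInf_le (s := (fun τ₂ : X → ℝ => ∫ x, |g x - τ₂ x| ∂p) '' H)
      (a := ∫ x, |g x - f₀ x| ∂p) ?_ ⟨f₀, hf₀, rfl⟩).trans ?_
    · refine ⟨0, ?_⟩
      rintro _ ⟨r, -, rfl⟩
      exact integral_nonneg fun x => abs_nonneg _
    · refine integral_abs_sub_le hg.1 (hH hf₀).1 fun x => abs_le.2 ?_
      have h1 := hg.2 x
      have h2 := (hH hf₀).2 x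
      constructor <;> linarith
  have hle : sInf ((fun τ₂ : X → ℝ => ∫ x, |τ x - τ₂ x| ∂p) '' H) ≤ approxErrorRatio p C H :=
    le_csSup hbdd ⟨τ, hτ, rfl⟩
  obtain ⟨_, ⟨τ', hτ', rfl⟩, hlt⟩ :=
    exists_lt_of_csInf_lt (hne.image _) (hle.trans_lt (lt_add_of_pos_right _ hδ))
  exact ⟨τ', hτ', hlt.le⟩

end Approximation

namespace Problem

/-! ### The saddle objective as an expected loss -/

section ExpectedLoss

variable {S A : Type*} [MeasurableSpace S] [MeasurableSpace A] (M : Problem S A)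

instance : IsMarkovKernel M.trans := M.isMarkovKernel_trans

instance : IsMarkovKernel M.policy := M.isMarkovKernel_policy

instance : IsProbabilityMeasure M.init := M.isProbabilityMeasure_init

instance : IsProbabilityMeasure M.data := M.isProbabilityMeasure_data

instance : IsMarkovKernel M.pairKernel := by unfold pairKernel; infer_instance

instance : IsProbabilityMeasure M.initPair := by unfold initPair; infer_instance

instance : IsProbabilityMeasure M.pairLaw := by unfold pairLaw; infer_instance

theorem map_fst_pairLaw : M.pairLaw.map Prod.fst = M.data := by
  have h := Measure.fst_compProd M.data M.pairKernel
  rwa [Measure.fst] at h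

theorem map_snd_pairLaw : M.pairLaw.map Prod.snd = M.data.bind M.pairKernel := by
  have h := Measure.snd_compProd M.data M.pairKernel
  rwa [Measure.snd] at h

/-- A joint law of `(x₀, x, x')` with the marginals of the sampling model. -/
structure IsTripleLaw (P : Measure ((S × A) × (S × A) × (S × A))) : Prop where
  map_fst : P.map Prod.fst = M.initPair
  map_snd : P.map Prod.snd = M.pairLaw

variable {M} {P : Measure ((S × A) × (S × A) × (S × A))}

theorem IsTripleLaw.integral_init (hP : M.IsTripleLaw P) {k : S × A → ℝ} (hk : Measurable k) :
    ∫ z, k z.1 ∂P = ∫ x, k x ∂M.initPair := by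
  rw [← hP.map_fst, integral_map measurable_fst.aemeasurable hk.aestronglyMeasurable]

theorem IsTripleLaw.integral_pair (hP : M.IsTripleLaw P) {k : (S × A) × (S × A) → ℝ}
    (hk : Measurable k) : ∫ z, k z.2 ∂P = ∫ x, k x ∂M.pairLaw := by
  rw [← hP.map_snd, integral_map measurable_snd.aemeasurable hk.aestronglyMeasurable]

theorem IsTripleLaw.integral_data (hP : M.IsTripleLaw P) {k : S × A → ℝ} (hk : Measurable k) :
    ∫ z, k z.2.1 ∂P = ∫ x, k x ∂M.data := by
  rw [hP.integral_pair (k := fun y => k y.1) (hk.comp measurable_fst), ← M.map_fst_pairLaw,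
    integral_map measurable_fst.aemeasurable hk.aestronglyMeasurable]

/-- The one-step operator applied to the data distribution controls the losses at the initial and
at the successor pair. -/
theorem IsTripleLaw.integral_op_le [IsProbabilityMeasure P] (hP : M.IsTripleLaw P) {B : NNReal}
    (hB : M.op M.data ≤ B • M.data) {k : S × A → ℝ} (hk : Measurable k) (hk0 : ∀ x, 0 ≤ k x)
    {b : ℝ} (hb : ∀ x, |k x| ≤ b) :
    ∫ z, ((1 - M.gamma) * k z.1 + M.gamma * k z.2.2) ∂P ≤ B * ∫ x, k x ∂M.data := by
  have hi : ∀ (ρ : Measure (S × A)) [IsFiniteMeasure ρ], Integrable k ρ := fun ρ _ =>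
    integrable_of_abs_le hk hb
  have hbind : IsProbabilityMeasure (M.data.bind M.pairKernel) := by
    rw [← M.map_snd_pairLaw]
    exact Measure.isProbabilityMeasure_map measurable_snd.aemeasurable
  have h1 : ∫ x, k x ∂(M.op M.data)
      = (1 - M.gamma) * ∫ x, k x ∂M.initPair
        + M.gamma * ∫ x, k x ∂(M.data.bind M.pairKernel) := by
    rw [op, integral_add_measure ((hi _).smul_measure ENNReal.ofReal_ne_top)
      ((hi _).smul_measure ENNReal.ofReal_ne_top), integral_smul_measure, integral_smul_measure,
      ENNReal.toReal_ofReal (by linarith [M.gamma_le_one]), ENNReal.toReal_ofReal M.gamma_pos.le,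
      smul_eq_mul, smul_eq_mul]
  have h2 : ∫ x, k x ∂(M.op M.data) ≤ ∫ x, k x ∂(B • M.data) :=
    integral_mono_measure hB (Filter.Eventually.of_forall hk0) (hi _)
  rw [integral_smul_nnreal_measure, NNReal.smul_def, smul_eq_mul] at h2
  have h3 : ∫ z, k z.2.2 ∂P = ∫ x, k x ∂(M.data.bind M.pairKernel) := by
    rw [hP.integral_pair (k := fun y => k y.2) (hk.comp measurable_snd), ← M.map_snd_pairLaw,
      integral_map measurable_snd.aemeasurable hk.aestronglyMeasurable]
  have hi1 : Integrable (fun z : (S × A) × (S × A) × (S × A) => k z.1) P :=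
    integrable_of_abs_le (hk.comp measurable_fst) fun z => hb _
  have hi2 : Integrable (fun z : (S × A) × (S × A) × (S × A) => k z.2.2) P :=
    integrable_of_abs_le (hk.comp (measurable_snd.comp measurable_snd)) fun z => hb _
  rw [integral_add (hi1.const_mul _) (hi2.const_mul _), integral_const_mul, integral_const_mul, h3,
    hP.integral_init hk]
  linarith

variable (M)

/-- The part of the loss that does not depend on the scalar dual variable. -/
def baseLoss (φ : ℝ → ℝ) (τ f : S × A → ℝ) (z : (S × A) × (S × A) × (S × A)) : ℝ :=
  (1 - M.gamma) * f z.1 + M.gamma * (τ z.2.1 * f z.2.2) - τ z.2.1 * conj φ (f z.2.1)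

/-- Separates the scalar variable, which brings the empirical objective to the form `dualValue`. -/
theorem loss_eq (φ : ℝ → ℝ) (lam : ℝ) (τ : S × A → ℝ) (u : ℝ) (f : S × A → ℝ)
    (z : (S × A) × (S × A) × (S × A)) :
    M.loss φ lam τ u f z = M.baseLoss φ τ f z + lam * (u * (τ z.2.1 - 1) - u ^ 2 / 2) := by
  unfold loss baseLoss
  ring

variable {M} {φ : ℝ → ℝ} {C : ℝ} {κ : NNReal}

theorem nonneg_of_mem_ratioBall {X : Type*} [MeasurableSpace X] [Nonempty X] {τ : X → ℝ}
    (hτ : τ ∈ ratioBall C) : 0 ≤ C :=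
  (hτ.2 (Classical.arbitrary X)).1.trans (hτ.2 _).2

theorem abs_le_of_mem_ratioBall {X : Type*} [MeasurableSpace X] {τ : X → ℝ}
    (hτ : τ ∈ ratioBall C) (x : X) : |τ x| ≤ C := by
  rw [abs_of_nonneg (hτ.2 x).1]
  exact (hτ.2 x).2

/-- The difference is telescoped: first `f` changes with the weight `τ'` held fixed and bounded by
`C`, then `τ` changes with coefficient `γ f(x') - φ*(f(x))`, which is bounded on `[-C, C]`. -/
theorem abs_baseLoss_sub_le (hC : 0 ≤ C) (hκ : LipschitzOnWith κ (conj φ) (Icc (-C) C))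
    {τ τ' f f' : S × A → ℝ} (hτ' : τ' ∈ ratioBall C)
    (hf : ∀ x, |f x| ≤ C) (hf' : ∀ x, |f' x| ≤ C) (z : (S × A) × (S × A) × (S × A)) :
    |M.baseLoss φ τ f z - M.baseLoss φ τ' f' z|
      ≤ ((1 - M.gamma) * |f z.1 - f' z.1| + M.gamma * (C * |f z.2.2 - f' z.2.2|))
        + C * κ * |f z.2.1 - f' z.2.1|
        + (C + (|conj φ 0| + κ * C)) * |τ z.2.1 - τ' z.2.1| := by
  obtain ⟨x, y, w⟩ := z
  have hγ0 := M.gamma_pos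
  have hγ1 := M.gamma_le_one
  simp only [baseLoss]
  have heq : (1 - M.gamma) * f x + M.gamma * (τ y * f w) - τ y * conj φ (f y)
      - ((1 - M.gamma) * f' x + M.gamma * (τ' y * f' w) - τ' y * conj φ (f' y))
      = (1 - M.gamma) * (f x - f' x) + M.gamma * (τ' y * (f w - f' w))
        + -(τ' y * (conj φ (f y) - conj φ (f' y)))
        + (M.gamma * f w - conj φ (f y)) * (τ y - τ' y) := by ring
  rw [heq]
  have h1 : |(1 - M.gamma) * (f x - f' x)| ≤ (1 - M.gamma) * |f x - f' x| := by
    rw [abs_mul, abs_of_nonneg (by linarith)]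
  have h2 : |M.gamma * (τ' y * (f w - f' w))| ≤ M.gamma * (C * |f w - f' w|) := by
    rw [abs_mul, abs_of_pos hγ0, abs_mul]
    have := abs_le_of_mem_ratioBall hτ' y
    gcongr
  have h3 : |-(τ' y * (conj φ (f y) - conj φ (f' y)))| ≤ C * κ * |f y - f' y| := by
    rw [abs_neg, abs_mul, mul_assoc]
    exact mul_le_mul (abs_le_of_mem_ratioBall hτ' y) (abs_conj_sub_le hκ (hf y) (hf' y))
      (abs_nonneg _) hC
  have h4 : |(M.gamma * f w - conj φ (f y)) * (τ y - τ' y)|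
      ≤ (C + (|conj φ 0| + κ * C)) * |τ y - τ' y| := by
    rw [abs_mul]
    refine mul_le_mul_of_nonneg_right ((abs_sub _ _).trans (add_le_add ?_ ?_)) (abs_nonneg _)
    · rw [abs_mul, abs_of_pos hγ0]
      exact (mul_le_of_le_one_left (abs_nonneg _) hγ1).trans (hf w)
    · exact abs_conj_le hκ (hf y)
  exact (abs_add_le _ _).trans (add_le_add ((abs_add_le _ _).trans
    (add_le_add ((abs_add_le _ _).trans (add_le_add h1 h2)) h3)) h4)

theorem abs_baseLoss_le (hC : 0 ≤ C) (hκ : LipschitzOnWith κ (conj φ) (Icc (-C) C))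
    {τ f : S × A → ℝ} (hτ : τ ∈ ratioBall C) (hf : ∀ x, |f x| ≤ C)
    (z : (S × A) × (S × A) × (S × A)) :
    |M.baseLoss φ τ f z| ≤ C + (C + (|conj φ 0| + κ * C)) * C := by
  -- Comparison with the zero ratio, for which only the initial term survives.
  have h0 : (0 : S × A → ℝ) ∈ ratioBall C := ⟨measurable_const, fun _ => ⟨le_rfl, hC⟩⟩
  have h := abs_baseLoss_sub_le (M := M) (τ := τ) hC hκ h0 hf hf z
  have hγ0 := M.gamma_pos
  have hγ1 := M.gamma_le_one
  simp only [sub_self, abs_zero, mul_zero, add_zero, zero_add, Pi.zero_apply, sub_zero] at h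
  have h1 : |M.baseLoss φ 0 f z| ≤ C := by
    simp only [baseLoss, Pi.zero_apply, zero_mul, mul_zero, add_zero, sub_zero]
    rw [abs_mul, abs_of_nonneg (by linarith)]
    exact (mul_le_of_le_one_left (abs_nonneg _) (by linarith)).trans (hf _)
  have h2 : (C + (|conj φ 0| + κ * C)) * |τ z.2.1| ≤ (C + (|conj φ 0| + κ * C)) * C :=
    mul_le_mul_of_nonneg_left (abs_le_of_mem_ratioBall hτ _) (by positivity)
  have h3 := abs_sub_abs_le_abs_sub (M.baseLoss φ τ f z) (M.baseLoss φ 0 f z)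
  linarith

/-- Joint measurability in index and sample point is the input of the measurable projection
argument. -/
theorem measurable_baseLoss_uncurry (hκ : LipschitzOnWith κ (conj φ) (Icc (-C) C))
    {T T' : Type*} [MeasurableSpace T] [MeasurableSpace T'] {gτ : T → S × A → ℝ}
    {gf : T' → S × A → ℝ} (hgτ : Measurable (Function.uncurry gτ))
    (hgf : Measurable (Function.uncurry gf)) (hgfC : ∀ t x, |gf t x| ≤ C) :
    Measurable (Function.uncurry fun t : T × T' => M.baseLoss φ (gτ t.1) (gf t.2)) := by
  obtain ⟨ψ, hψ, heq⟩ := exists_measurable_eq_conj hκ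
  have h1 : Measurable fun q : (T × T') × (S × A) × (S × A) × (S × A) => gf q.1.2 q.2.1 :=
    hgf.comp (by fun_prop : Measurable fun q : (T × T') × (S × A) × (S × A) × (S × A) =>
      (q.1.2, q.2.1))
  have h2 : Measurable fun q : (T × T') × (S × A) × (S × A) × (S × A) => gf q.1.2 q.2.2.1 :=
    hgf.comp (by fun_prop : Measurable fun q : (T × T') × (S × A) × (S × A) × (S × A) =>
      (q.1.2, q.2.2.1))
  have h3 : Measurable fun q : (T × T') × (S × A) × (S × A) × (S × A) => gf q.1.2 q.2.2.2 :=
    hgf.comp (by fun_prop : Measurable fun q : (T × T') × (S × A) × (S × A) × (S × A) =>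
      (q.1.2, q.2.2.2))
  have h4 : Measurable fun q : (T × T') × (S × A) × (S × A) × (S × A) => gτ q.1.1 q.2.2.1 :=
    hgτ.comp (by fun_prop : Measurable fun q : (T × T') × (S × A) × (S × A) × (S × A) =>
      (q.1.1, q.2.2.1))
  have h5 : (Function.uncurry fun t : T × T' => M.baseLoss φ (gτ t.1) (gf t.2))
      = fun q => (1 - M.gamma) * gf q.1.2 q.2.1 + M.gamma * (gτ q.1.1 q.2.2.1 * gf q.1.2 q.2.2.2)
        - gτ q.1.1 q.2.2.1 * ψ (gf q.1.2 q.2.2.1) := by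
    funext q
    simp only [Function.uncurry, baseLoss, heq _ (hgfC _ _)]
  rw [h5]
  exact ((h1.const_mul _).add ((h4.mul h3).const_mul _)).sub (h4.mul (hψ.comp h2))

theorem measurable_baseLoss (hκ : LipschitzOnWith κ (conj φ) (Icc (-C) C)) {τ f : S × A → ℝ}
    (hτ : Measurable τ) (hf : f ∈ dualBall C) : Measurable (M.baseLoss φ τ f) := by
  have h := measurable_baseLoss_uncurry (M := M) (T := Unit) (T' := Unit) hκ
    (gτ := fun _ => τ) (gf := fun _ => f) (hτ.comp measurable_snd) (hf.1.comp measurable_snd)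
    fun _ => hf.2
  exact h.comp (measurable_prodMk_left (x := ((), ())))

/-- Each term involves either `x₀` or `(x, x')` alone, so every coupling of the two marginals gives
the same value. -/
theorem IsTripleLaw.saddle_eq [IsProbabilityMeasure P] (hP : M.IsTripleLaw P)
    (hκ : LipschitzOnWith κ (conj φ) (Icc (-C) C)) (hC : 0 ≤ C) {τ f : S × A → ℝ}
    (hτ : τ ∈ ratioBall C) (hf : f ∈ dualBall C) (lam u : ℝ) :
    M.saddle φ lam τ u f = ∫ z, M.baseLoss φ τ f z ∂P
      + lam * (u * (∫ x, τ x ∂M.data - 1) - u ^ 2 / 2) := by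
  have hτb := abs_le_of_mem_ratioBall hτ
  obtain ⟨ψ, hψ, hψe⟩ := exists_measurable_eq_conj hκ
  have hconj : Measurable fun x => conj φ (f x) := by
    have : (fun x => conj φ (f x)) = fun x => ψ (f x) := funext fun x => hψe _ (hf.2 x)
    rw [this]
    exact hψ.comp hf.1
  have hm2 : Measurable fun y : (S × A) × (S × A) => τ y.1 * f y.2 :=
    (hτ.1.comp measurable_fst).mul (hf.1.comp measurable_snd)
  have hm3 : Measurable fun x => τ x * conj φ (f x) := hτ.1.mul hconj
  have hi1 : Integrable (fun z : (S × A) × (S × A) × (S × A) => f z.1) P :=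
    integrable_of_abs_le (hf.1.comp measurable_fst) fun z => hf.2 _
  have hi2 : Integrable (fun z : (S × A) × (S × A) × (S × A) => τ z.2.1 * f z.2.2) P :=
    integrable_of_abs_le (hm2.comp measurable_snd) (b := C * C) fun z => by
      rw [abs_mul]
      exact mul_le_mul (hτb _) (hf.2 _) (abs_nonneg _) hC
  have hi3 : Integrable (fun z : (S × A) × (S × A) × (S × A) => τ z.2.1 * conj φ (f z.2.1)) P :=
    integrable_of_abs_le (hm3.comp (measurable_fst.comp measurable_snd))
      (b := C * (|conj φ 0| + κ * C)) fun z => by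
      rw [abs_mul]
      exact mul_le_mul (hτb _) (abs_conj_le hκ (hf.2 _)) (abs_nonneg _) hC
  have hτi : Integrable τ M.data := integrable_of_abs_le hτ.1 hτb
  have hu : ∫ x, (u * τ x - u) ∂M.data = u * (∫ x, τ x ∂M.data - 1) := by
    rw [integral_sub (hτi.const_mul u) (integrable_const u), integral_const_mul]
    simp
    ring
  have hi12 : Integrable (fun z : (S × A) × (S × A) × (S × A) =>
      (1 - M.gamma) * f z.1 + M.gamma * (τ z.2.1 * f z.2.2)) P :=
    (hi1.const_mul _).add (hi2.const_mul _)
  simp only [baseLoss]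
  rw [integral_sub hi12 hi3,
    integral_add (hi1.const_mul _) (hi2.const_mul _), integral_const_mul, integral_const_mul,
    hP.integral_init hf.1, hP.integral_pair hm2, hP.integral_data hm3, saddle, hu]

theorem IsTripleLaw.objective_eq [IsProbabilityMeasure P] (hP : M.IsTripleLaw P)
    (hκ : LipschitzOnWith κ (conj φ) (Icc (-C) C)) (hC : 0 ≤ C) {τ : S × A → ℝ}
    (hτ : τ ∈ ratioBall C) (lam : ℝ) :
    M.objective φ lam C τ = dualValue lam (dualBall C) (fun f => ∫ z, M.baseLoss φ τ f z ∂P)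
      (∫ x, τ x ∂M.data) := by
  unfold objective dualValue
  congr 1
  exact image_congr fun q hq => hP.saddle_eq hκ hC hτ hq.1 lam q.2

theorem empObjective_eq {N : ℕ} (hN : N ≠ 0) (lam : ℝ) (F : Set (S × A → ℝ))
    (z : Fin N → (S × A) × (S × A) × (S × A)) (τ : S × A → ℝ) :
    M.empObjective φ lam F z τ = dualValue lam F (fun f => (∑ i, M.baseLoss φ τ f (z i)) / N)
      ((∑ i, τ (z i).2.1) / N) := by
  unfold empObjective dualValue
  congr 1
  refine image_congr fun q _ => ?_
  have hN' : (N : ℝ) ≠ 0 := by exact_mod_cast hN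
  simp only [empSaddle, loss_eq]
  rw [Finset.sum_add_distrib, ← Finset.mul_sum, Finset.sum_sub_distrib, ← Finset.mul_sum,
    Finset.sum_sub_distrib]
  simp only [Finset.sum_const, Finset.card_univ, Fintype.card_fin, nsmul_eq_mul, mul_one]
  field_simp

/-- The saddle objective depends only on the class of the ratio modulo null sets. -/
theorem objective_congr_ae {τ τ' : S × A → ℝ} (h : τ =ᵐ[M.data] τ') (lam : ℝ) :
    M.objective φ lam C τ = M.objective φ lam C τ' := by
  have h2 : ∀ᵐ z ∂M.pairLaw, τ z.1 = τ' z.1 := by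
    have h3 := h
    rw [← M.map_fst_pairLaw] at h3
    exact ae_of_ae_map measurable_fst.aemeasurable h3
  unfold objective
  congr 1
  refine image_congr fun q _ => ?_
  unfold saddle
  congr 1
  · congr 1
    · congr 2
      refine integral_congr_ae ?_
      filter_upwards [h2] with z hz
      rw [hz]
    · refine integral_congr_ae ?_
      filter_upwards [h] with z hz
      rw [hz]
  · congr 2
    refine integral_congr_ae ?_
    filter_upwards [h] with z hz
    rw [hz]

end ExpectedLoss

section Estimation

variable {S A : Type*} [MeasurableSpace S] [MeasurableSpace A] {M : Problem S A}
  {P : Measure ((S × A) × (S × A) × (S × A))} {φ : ℝ → ℝ} {C : ℝ} {κ : NNReal}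

/-! ### Stability of the expected loss -/

theorem integrable_baseLoss [IsProbabilityMeasure P] (hC : 0 ≤ C)
    (hκ : LipschitzOnWith κ (conj φ) (Icc (-C) C)) {τ f : S × A → ℝ} (hτ : τ ∈ ratioBall C)
    (hf : f ∈ dualBall C) : Integrable (M.baseLoss φ τ f) P :=
  integrable_of_abs_le (measurable_baseLoss hκ hτ.1 hf) (abs_baseLoss_le hC hκ hτ hf.2)

/-- The changes at `x₀` and `x'` carry weights `1 - γ` and `γ C`. Enlarging them to `(1 + C) (1 -
γ)` and `(1 + C) γ` gives a multiple of the integral against $\mathcal T\circ p\le Bp$; the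
Lipschitz bound on $\phi^*$ handles `x`. -/
theorem IsTripleLaw.integral_baseLoss_le_dual [IsProbabilityMeasure P] (hP : M.IsTripleLaw P)
    (hC : 0 ≤ C) (hκ : LipschitzOnWith κ (conj φ) (Icc (-C) C)) {B : NNReal}
    (hB : M.op M.data ≤ B • M.data) {τ f f' : S × A → ℝ} (hτ : τ ∈ ratioBall C)
    (hf : f ∈ dualBall C) (hf' : f' ∈ dualBall C) :
    ∫ z, M.baseLoss φ τ f z ∂P ≤ ∫ z, M.baseLoss φ τ f' z ∂P
      + ((1 + C) * B + C * κ) * ∫ x, |f x - f' x| ∂M.data := by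
  let d : S × A → ℝ := fun x => |f x - f' x|
  have hd : Measurable d := (hf.1.sub hf'.1).abs
  have hdb : ∀ x, |d x| ≤ 2 * C := fun x => by
    rw [abs_abs]
    exact (abs_sub _ _).trans (by linarith [hf.2 x, hf'.2 x])
  have hγ0 := M.gamma_pos
  have hγ1 := M.gamma_le_one
  have hi1 : Integrable (fun z : (S × A) × (S × A) × (S × A) =>
      (1 - M.gamma) * d z.1 + M.gamma * d z.2.2) P :=
    ((integrable_of_abs_le (hd.comp measurable_fst) fun z => hdb _).const_mul _).add
      ((integrable_of_abs_le (hd.comp (measurable_snd.comp measurable_snd))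
        fun z => hdb _).const_mul _)
  have hi2 : Integrable (fun z : (S × A) × (S × A) × (S × A) => d z.2.1) P :=
    integrable_of_abs_le (hd.comp (measurable_fst.comp measurable_snd)) fun z => hdb _
  have hpt : ∀ z, M.baseLoss φ τ f z ≤ M.baseLoss φ τ f' z
      + ((1 + C) * ((1 - M.gamma) * d z.1 + M.gamma * d z.2.2) + C * κ * d z.2.1) := by
    intro z
    have h := (le_abs_self _).trans
      (abs_baseLoss_sub_le (M := M) (τ := τ) hC hκ hτ hf.2 hf'.2 z)
    rw [sub_self, abs_zero, mul_zero, add_zero] at h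
    have h1 : 0 ≤ C * ((1 - M.gamma) * d z.1) :=
      mul_nonneg hC (mul_nonneg (by linarith) (abs_nonneg _))
    have h2 : 0 ≤ M.gamma * d z.2.2 := mul_nonneg hγ0.le (abs_nonneg _)
    simp only [d] at h1 h2 ⊢
    nlinarith
  have hop := hP.integral_op_le hB hd (fun x => abs_nonneg _) hdb
  have hi3 : Integrable (fun z : (S × A) × (S × A) × (S × A) =>
      (1 + C) * ((1 - M.gamma) * d z.1 + M.gamma * d z.2.2) + C * κ * d z.2.1) P :=
    (hi1.const_mul (1 + C)).add (hi2.const_mul (C * κ))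
  have hint := integral_mono (integrable_baseLoss hC hκ hτ hf)
    ((integrable_baseLoss hC hκ hτ hf').add hi3) hpt
  have heq : ∫ z, (M.baseLoss φ τ f' z + ((1 + C) * ((1 - M.gamma) * d z.1 + M.gamma * d z.2.2)
      + C * κ * d z.2.1)) ∂P = ∫ z, M.baseLoss φ τ f' z ∂P
        + ((1 + C) * ∫ z, ((1 - M.gamma) * d z.1 + M.gamma * d z.2.2) ∂P
        + C * κ * ∫ x, d x ∂M.data) := by
    rw [integral_add (integrable_baseLoss hC hκ hτ hf') hi3, integral_add (hi1.const_mul (1 + C)) (hi2.const_mul (C * κ)),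
      integral_const_mul, integral_const_mul, hP.integral_data hd]
  have hint' := hint.trans heq.le
  have h1 : (1 + C) * ∫ z, ((1 - M.gamma) * d z.1 + M.gamma * d z.2.2) ∂P
      ≤ (1 + C) * (B * ∫ x, d x ∂M.data) := mul_le_mul_of_nonneg_left hop (by linarith)
  simp only [d] at hint' h1
  linarith

theorem IsTripleLaw.integral_baseLoss_le_ratio [IsProbabilityMeasure P] (hP : M.IsTripleLaw P)
    (hC : 0 ≤ C) (hκ : LipschitzOnWith κ (conj φ) (Icc (-C) C)) {τ τ' f : S × A → ℝ}
    (hτ : τ ∈ ratioBall C) (hτ' : τ' ∈ ratioBall C) (hf : f ∈ dualBall C) :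
    ∫ z, M.baseLoss φ τ f z ∂P ≤ ∫ z, M.baseLoss φ τ' f z ∂P
      + (C + (|conj φ 0| + κ * C)) * ∫ x, |τ x - τ' x| ∂M.data := by
  let d : S × A → ℝ := fun x => |τ x - τ' x|
  have hd : Measurable d := (hτ.1.sub hτ'.1).abs
  have hdb : ∀ x, |d x| ≤ C := fun x => by
    rw [abs_abs, abs_le]
    have h1 := hτ.2 x
    have h2 := hτ'.2 x
    constructor <;> linarith
  have hi : Integrable (fun z : (S × A) × (S × A) × (S × A) => d z.2.1) P :=
    integrable_of_abs_le (hd.comp (measurable_fst.comp measurable_snd)) fun z => hdb _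
  have hpt : ∀ z, M.baseLoss φ τ f z ≤ M.baseLoss φ τ' f z
      + (C + (|conj φ 0| + κ * C)) * d z.2.1 := by
    intro z
    have h := (le_abs_self _).trans
      (abs_baseLoss_sub_le (M := M) (τ := τ) hC hκ hτ' hf.2 hf.2 z)
    simp only [sub_self, abs_zero, mul_zero, add_zero, zero_add] at h
    simp only [d]
    linarith
  have hint := integral_mono (integrable_baseLoss hC hκ hτ hf)
    ((integrable_baseLoss hC hκ hτ' hf).add (hi.const_mul _)) hpt
  refine hint.trans (le_of_eq ?_)
  simp only [Pi.add_apply]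
  rw [integral_add (integrable_baseLoss hC hκ hτ' hf) (hi.const_mul _), integral_const_mul,
    hP.integral_data hd]

/-! ### Bounds on the primal objectives -/

/-- Bounds the optimal scalar dual variable; this is the radius `R = C + 1` used with
`dualValue_le_dualValue`. -/
theorem abs_mean_sub_one_le {X : Type*} [MeasurableSpace X] {p : Measure X}
    [IsProbabilityMeasure p] {τ : X → ℝ} (hτ : τ ∈ ratioBall C) :
    |∫ x, τ x ∂p - 1| ≤ C + 1 := by
  have h0 : 0 ≤ ∫ x, τ x ∂p := integral_nonneg fun x => (hτ.2 x).1
  have h1 := integral_mono (μ := p) (integrable_of_abs_le hτ.1 (abs_le_of_mem_ratioBall hτ))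
    (integrable_const C) fun x => (hτ.2 x).2
  simp only [integral_const, probReal_univ, one_smul] at h1
  rw [abs_le]
  constructor <;> linarith

theorem abs_sum_div_le {N : ℕ} (hN : N ≠ 0) {b : ℝ} {a : Fin N → ℝ} (ha : ∀ i, |a i| ≤ b) :
    |(∑ i, a i) / N| ≤ b := by
  have hN' : (0 : ℝ) < N := by exact_mod_cast Nat.pos_of_ne_zero hN
  rw [abs_div, abs_of_pos hN', div_le_iff₀ hN']
  refine (Finset.abs_sum_le_sum_abs _ _).trans ((Finset.sum_le_sum fun i _ => ha i).trans ?_)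
  simp [mul_comm]

theorem abs_sampleMean_sub_one_le {X : Type*} [MeasurableSpace X] {N : ℕ} (hN : N ≠ 0)
    {τ : X → ℝ} (hτ : τ ∈ ratioBall C) (x : Fin N → X) : |(∑ i, τ (x i)) / N - 1| ≤ C + 1 := by
  have h1 := abs_le.1 (abs_sum_div_le hN fun i => abs_le_of_mem_ratioBall hτ (x i))
  rw [abs_le]
  have h2 : 0 ≤ (∑ i, τ (x i)) / N :=
    div_nonneg (Finset.sum_nonneg fun i _ => (hτ.2 _).1) (Nat.cast_nonneg _)
  constructor <;> linarith

/-- A uniform bound on the losses. -/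
def lossBound (φ : ℝ → ℝ) (C : ℝ) (κ : NNReal) : ℝ := C + (C + (|conj φ 0| + κ * C)) * C

theorem abs_integral_baseLoss_le [IsProbabilityMeasure P] (hC : 0 ≤ C)
    (hκ : LipschitzOnWith κ (conj φ) (Icc (-C) C)) {τ f : S × A → ℝ} (hτ : τ ∈ ratioBall C)
    (hf : f ∈ dualBall C) : |∫ z, M.baseLoss φ τ f z ∂P| ≤ lossBound φ C κ := by
  have h := norm_integral_le_of_norm_le_const (μ := P) (f := M.baseLoss φ τ f)
    (C := lossBound φ C κ) (Filter.Eventually.of_forall (abs_baseLoss_le hC hκ hτ hf.2))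
  simpa using h

theorem zero_mem_dualBall {X : Type*} [MeasurableSpace X] (hC : 0 ≤ C) :
    (0 : X → ℝ) ∈ dualBall C := ⟨measurable_const, fun _ => by simpa using hC⟩

theorem IsTripleLaw.abs_objective_le [IsProbabilityMeasure P] (hP : M.IsTripleLaw P)
    (hC : 0 ≤ C) (hκ : LipschitzOnWith κ (conj φ) (Icc (-C) C)) {τ : S × A → ℝ}
    (hτ : τ ∈ ratioBall C) {lam : ℝ} (hlam : 0 < lam) :
    |M.objective φ lam C τ| ≤ lossBound φ C κ + lam * ((C + 1) ^ 2 / 2) := by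
  rw [hP.objective_eq hκ hC hτ]
  exact abs_dualValue_le hlam ⟨0, zero_mem_dualBall hC⟩
    (fun f hf => abs_integral_baseLoss_le hC hκ hτ hf) (abs_mean_sub_one_le hτ)

theorem abs_empObjective_le (hC : 0 ≤ C) (hκ : LipschitzOnWith κ (conj φ) (Icc (-C) C))
    {F : Set (S × A → ℝ)} (hF : F ⊆ dualBall C) (hne : F.Nonempty) {τ : S × A → ℝ}
    (hτ : τ ∈ ratioBall C) {lam : ℝ} (hlam : 0 < lam) {N : ℕ} (hN : N ≠ 0)
    (z : Fin N → (S × A) × (S × A) × (S × A)) :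
    |M.empObjective φ lam F z τ| ≤ lossBound φ C κ + lam * ((C + 1) ^ 2 / 2) := by
  rw [empObjective_eq hN]
  exact abs_dualValue_le hlam hne
    (fun f hf => abs_sum_div_le hN fun i => abs_baseLoss_le hC hκ hτ (hF hf).2 (z i))
    (abs_sampleMean_sub_one_le hN hτ fun i => (z i).2.1)

theorem abs_optError_le (hC : 0 ≤ C) (hκ : LipschitzOnWith κ (conj φ) (Icc (-C) C))
    {H F : Set (S × A → ℝ)} (hH : H ⊆ ratioBall C) (hF : F ⊆ dualBall C) (hne : F.Nonempty)
    {τ : S × A → ℝ} (hτ : τ ∈ H) {lam : ℝ} (hlam : 0 < lam) {N : ℕ} (hN : N ≠ 0)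
    (z : Fin N → (S × A) × (S × A) × (S × A)) :
    |M.optError φ lam H F z τ| ≤ 2 * (lossBound φ C κ + lam * ((C + 1) ^ 2 / 2)) := by
  set b := lossBound φ C κ + lam * ((C + 1) ^ 2 / 2)
  have hb : ∀ τ' ∈ H, |M.empObjective φ lam F z τ'| ≤ b := fun τ' hτ' =>
    abs_empObjective_le hC hκ hF hne (hH hτ') hlam hN z
  have h1 : -b ≤ sInf (M.empObjective φ lam F z '' H) := by
    refine le_csInf ⟨_, mem_image_of_mem _ hτ⟩ ?_
    rintro _ ⟨τ', hτ', rfl⟩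
    exact (abs_le.1 (hb τ' hτ')).1
  have h2 : sInf (M.empObjective φ lam F z '' H) ≤ b := by
    refine (csInf_le ⟨-b, ?_⟩ (mem_image_of_mem _ hτ)).trans (abs_le.1 (hb τ hτ)).2
    rintro _ ⟨τ', hτ', rfl⟩
    exact (abs_le.1 (hb τ' hτ')).1
  have h3 := abs_le.1 (hb τ hτ)
  unfold optError
  rw [abs_le]
  constructor <;> linarith

/-! ### Decomposition of the error -/

/-- The error of an estimate in terms of its optimization error, the approximation errors, and
uniform bounds `h₁`, `h₂` on the deviations of the empirical means. -/
theorem IsTripleLaw.objective_sub_le [IsProbabilityMeasure P] (hP : M.IsTripleLaw P)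
    (hC : 0 ≤ C) (hκ : LipschitzOnWith κ (conj φ) (Icc (-C) C)) {lam : ℝ} (hlam : 0 < lam)
    {B : NNReal} (hB : M.op M.data ≤ B • M.data) {H F : Set (S × A → ℝ)}
    (hH : H ⊆ ratioBall C) (hF : F ⊆ dualBall C) (hne : F.Nonempty) {N : ℕ} (hN : N ≠ 0)
    (z : Fin N → (S × A) × (S × A) × (S × A)) {h₁ h₂ : ℝ}
    (hdev₁ : ∀ τ ∈ H, ∀ f ∈ F,
      |(∑ i, M.baseLoss φ τ f (z i)) / N - ∫ z, M.baseLoss φ τ f z ∂P| ≤ h₁)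
    (hdev₂ : ∀ τ ∈ H, |(∑ i, τ (z i).2.1) / N - ∫ x, τ x ∂M.data| ≤ h₂)
    {τ τ' : S × A → ℝ} (hτ : τ ∈ H) (hτ' : τ' ∈ ratioBall C) :
    M.objective φ lam C τ - M.objective φ lam C τ' ≤ M.optError φ lam H F z τ
      + ((1 + C) * B + C * κ) * approxErrorDual M.data C F
      + (C + (|conj φ 0| + κ * C) + lam * (C + 1)) * approxErrorRatio M.data C H
      + 2 * (h₁ + lam * (C + 1) * h₂) := by
  set K₁ : ℝ := (1 + C) * B + C * κ with hK₁
  set K₂ : ℝ := C + (|conj φ 0| + κ * C) with hK₂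
  have hK₁0 : 0 ≤ K₁ := by positivity
  have hK₂0 : 0 ≤ K₂ + lam * (C + 1) := by positivity
  have hdual : (dualBall C : Set (S × A → ℝ)).Nonempty := ⟨0, zero_mem_dualBall hC⟩
  have hpop : ∀ τ ∈ (ratioBall C : Set (S × A → ℝ)), ∀ f ∈ dualBall C,
      ∫ z, M.baseLoss φ τ f z ∂P ≤ lossBound φ C κ := fun τ hτ f hf =>
    (abs_le.1 (abs_integral_baseLoss_le hC hκ hτ hf)).2
  have hemp : ∀ τ ∈ (ratioBall C : Set (S × A → ℝ)), ∀ f ∈ F,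
      (∑ i, M.baseLoss φ τ f (z i)) / N ≤ lossBound φ C κ := fun τ hτ f hf =>
    (abs_le.1 (abs_sum_div_le hN fun i => abs_baseLoss_le hC hκ hτ (hF hf).2 (z i))).2
  -- The supremum shrinks from the dual ball to `F`, so this is the only link that pays the dual
  -- approximation error.
  have hstep₁ : M.objective φ lam C τ ≤ M.empObjective φ lam F z τ
      + (K₁ * approxErrorDual M.data C F + h₁) + lam * (C + 1) * h₂ := by
    rw [hP.objective_eq hκ hC (hH hτ), empObjective_eq hN]
    refine dualValue_le_dualValue hlam hdual (hemp τ (hH hτ)) (abs_mean_sub_one_le (hH hτ))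
      (by rw [abs_sub_comm]; exact hdev₂ τ hτ) fun f hf δ hδ => ?_
    -- The slack is divided by `K₁ + 1` rather than `K₁`, which may vanish.
    obtain ⟨f', hf', happ⟩ := exists_integral_abs_sub_le_dual (p := M.data) hF hne hC hf
      (div_pos hδ (by linarith : 0 < K₁ + 1))
    refine ⟨f', hf', ?_⟩
    have h1 := hP.integral_baseLoss_le_dual hC hκ hB (hH hτ) hf (hF hf')
    have h2 := (abs_le.1 (hdev₁ τ hτ f' hf')).1
    have h3 := mul_le_mul_of_nonneg_left happ hK₁0
    have h4 : K₁ * (δ / (K₁ + 1)) ≤ δ := by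
      rw [mul_div_assoc', div_le_iff₀ (by linarith)]
      nlinarith
    linarith
  refine le_of_forall_pos_le_add fun δ hδ => ?_
  obtain ⟨τ₀, hτ₀, happ⟩ := exists_integral_abs_sub_le_ratio (p := M.data) hH ⟨τ, hτ⟩ hτ'
    (div_pos hδ (by linarith : 0 < K₂ + lam * (C + 1) + 1))
  have hstep₂ : M.empObjective φ lam F z τ - M.optError φ lam H F z τ
      ≤ M.empObjective φ lam F z τ₀ := by
    have h1 : sInf (M.empObjective φ lam F z '' H) ≤ M.empObjective φ lam F z τ₀ := by
      refine csInf_le ⟨-(lossBound φ C κ + lam * ((C + 1) ^ 2 / 2)), ?_⟩ (mem_image_of_mem _ hτ₀)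
      rintro _ ⟨τ₁, hτ₁, rfl⟩
      exact (abs_le.1 (abs_empObjective_le hC hκ hF hne (hH hτ₁) hlam hN z)).1
    unfold optError
    linarith
  -- Here the supremum grows from `F` to the dual ball, so only deviations are paid.
  have hstep₃ : M.empObjective φ lam F z τ₀ ≤ M.objective φ lam C τ₀ + h₁
      + lam * (C + 1) * h₂ := by
    rw [hP.objective_eq hκ hC (hH hτ₀), empObjective_eq hN]
    refine dualValue_le_dualValue hlam hne (hpop τ₀ (hH hτ₀))
      (abs_sampleMean_sub_one_le hN (hH hτ₀) fun i => (z i).2.1) (hdev₂ τ₀ hτ₀)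
      fun f hf δ hδ => ⟨f, hF hf, ?_⟩
    linarith [(abs_le.1 (hdev₁ τ₀ hτ₀ f hf)).2]
  have hcomm : ∫ x, |τ₀ x - τ' x| ∂M.data = ∫ x, |τ' x - τ₀ x| ∂M.data := by
    simp_rw [abs_sub_comm]
  have hmean : |∫ x, τ₀ x ∂M.data - ∫ x, τ' x ∂M.data| ≤ ∫ x, |τ₀ x - τ' x| ∂M.data := by
    rw [← integral_sub (integrable_of_abs_le (hH hτ₀).1 (abs_le_of_mem_ratioBall (hH hτ₀)))
      (integrable_of_abs_le hτ'.1 (abs_le_of_mem_ratioBall hτ'))]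
    exact abs_integral_le_integral_abs
  -- A change of ratio acts on the base loss and on the mean of the ratio, whence the two
  -- coefficients.
  have hstep₄ : M.objective φ lam C τ₀ ≤ M.objective φ lam C τ'
      + K₂ * ∫ x, |τ₀ x - τ' x| ∂M.data + lam * (C + 1) * ∫ x, |τ₀ x - τ' x| ∂M.data := by
    rw [hP.objective_eq hκ hC (hH hτ₀), hP.objective_eq hκ hC hτ']
    refine dualValue_le_dualValue hlam hdual (hpop τ' hτ') (abs_mean_sub_one_le (hH hτ₀)) hmean
      fun f hf δ hδ => ⟨f, hf, ?_⟩
    linarith [hP.integral_baseLoss_le_ratio hC hκ (hH hτ₀) hτ' hf]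
  rw [hcomm] at hstep₄
  have h5 := mul_le_mul_of_nonneg_left happ hK₂0
  have h6 : (K₂ + lam * (C + 1)) * (δ / (K₂ + lam * (C + 1) + 1)) ≤ δ := by
    rw [mul_div_assoc', div_le_iff₀ (by linarith)]
    nlinarith
  linarith

end Estimation

section StatisticalError

variable {S A : Type*} [MeasurableSpace S] [MeasurableSpace A] {M : Problem S A}
  {P : Measure ((S × A) × (S × A) × (S × A))} {φ : ℝ → ℝ} {C : ℝ} {κ : NNReal}

/-! ### Statistical error -/

/-- Absorbs the net scale, of order `1 / N`, into the statistical rate. -/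
theorem inv_le_two_mul_sqrt_log {N : ℕ} (hN : 2 ≤ N) :
    1 / (N : ℝ) ≤ 2 * Real.sqrt (Real.log N / N) := by
  have hN2 : (2 : ℝ) ≤ N := by exact_mod_cast hN
  have hlog : 1 / 2 ≤ Real.log N := by
    have h1 := Real.log_le_log (by norm_num) hN2
    have h2 := Real.log_two_gt_d9
    linarith
  have h3 : 1 / (2 * (N : ℝ)) ≤ Real.sqrt (Real.log N / N) := by
    refine Real.le_sqrt_of_sq_le ?_
    rw [div_pow, one_pow, div_le_div_iff₀ (by positivity) (by positivity)]
    nlinarith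
  have h4 : 1 / (N : ℝ) = 2 * (1 / (2 * (N : ℝ))) := by field_simp
  linarith

/-- The left side is the base of the net cardinality for `c` points and `N` thresholds; a dual
function is evaluated at three points per sample, hence `3 * N`. -/
theorem succ_mul_le_pow_four {N c : ℕ} (hN : 2 ≤ N) (hc : c ≤ 3 * N) : c * N + 1 ≤ N ^ 4 := by
  have h1 : c * N ≤ 3 * N * N := Nat.mul_le_mul_right N hc
  have h2 : 4 ≤ N * N := Nat.mul_le_mul hN hN
  have h3 : 4 * (N * N) ≤ N * N * (N * N) := Nat.mul_le_mul_right _ h2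
  have h4 : N ^ 4 = N * N * (N * N) := by ring
  nlinarith

theorem log_two_mul_pow_le {N : ℕ} (hN : 2 ≤ N) (D : ℕ) :
    Real.log (2 * ((N ^ 4) ^ D : ℝ)) ≤ (4 * D + 1) * Real.log N := by
  have hN2 : (2 : ℝ) ≤ N := by exact_mod_cast hN
  rw [Real.log_mul (by norm_num) (by positivity), Real.log_pow, Real.log_pow]
  have h1 := Real.log_le_log (by norm_num) hN2
  push_cast
  linarith

/-- The scale factor of the nets of the loss class. -/
def netScale (φ : ℝ → ℝ) (C : ℝ) (κ : NNReal) : ℝ :=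
  1 + C + C * κ + (C + (|conj φ 0| + κ * C))

/-- The product of a net for the ratios and a net for the dual functions works because the loss is
Lipschitz in the values of both. The summands of `netScale` come from the initial term, the
successor term, the conjugate and the ratio. -/
theorem exists_finset_net_baseLoss (hC : 0 ≤ C)
    (hκ : LipschitzOnWith κ (conj φ) (Icc (-C) C)) {T T' : Type*} {gτ : T → S × A → ℝ}
    {gf : T' → S × A → ℝ} (hgτ : ∀ t, gτ t ∈ ratioBall C) (hgf : ∀ t x, |gf t x| ≤ C)
    {DH DF : ℕ} (hDH : pseudoDim (range gτ) ≤ DH) (hDF : pseudoDim (range gf) ≤ DF) {N : ℕ}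
    (hN : 2 ≤ N) (z : Fin N → (S × A) × (S × A) × (S × A)) :
    ∃ s : Finset (T × T'), (s.card : ℝ) ≤ (N ^ 4) ^ (DH + DF) ∧
      ∀ t : T × T', ∃ t' ∈ s, ∀ i, |M.baseLoss φ (gτ t.1) (gf t.2) (z i)
        - M.baseLoss φ (gτ t'.1) (gf t'.2) (z i)| ≤ netScale φ C κ * (2 * C / N) := by
  classical
  have hγ0 := M.gamma_pos
  have hγ1 := M.gamma_le_one
  have hN0 : 0 < N := by omega
  have hcard : ∀ e : Fin N → S × A, (Finset.univ.image e).card ≤ N := fun e =>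
    Finset.card_image_le.trans (by simp)
  let Pτ : Finset (S × A) := Finset.univ.image fun i => (z i).2.1
  let Pf : Finset (S × A) := (Finset.univ.image fun i => (z i).1) ∪
    ((Finset.univ.image fun i => (z i).2.1) ∪ Finset.univ.image fun i => (z i).2.2)
  have hPf : Pf.card ≤ 3 * N := by
    refine (Finset.card_union_le _ _).trans ?_
    have h1 := Finset.card_union_le (Finset.univ.image fun i => (z i).2.1)
      (Finset.univ.image fun i => (z i).2.2)
    have h2 := hcard fun i => (z i).1
    have h3 := hcard fun i => (z i).2.1
    have h4 := hcard fun i => (z i).2.2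
    omega
  obtain ⟨s, hs, hsn⟩ := exists_finset_net hDH (fun t => abs_le_of_mem_ratioBall (hgτ t)) Pτ
    (hcard _) hN0
  obtain ⟨s', hs', hsn'⟩ := exists_finset_net hDF hgf Pf hPf hN0
  refine ⟨s ×ˢ s', ?_, fun t => ?_⟩
  · rw [Finset.card_product, pow_add]
    have h1 := hs.trans (Nat.pow_le_pow_left (succ_mul_le_pow_four hN (by omega)) DH)
    have h2 := hs'.trans (Nat.pow_le_pow_left (succ_mul_le_pow_four hN le_rfl) DF)
    exact_mod_cast Nat.mul_le_mul h1 h2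
  · obtain ⟨t₁, ht₁, h₁⟩ := hsn t.1
    obtain ⟨t₂, ht₂, h₂⟩ := hsn' t.2
    refine ⟨(t₁, t₂), Finset.mk_mem_product ht₁ ht₂, fun i => ?_⟩
    refine (abs_baseLoss_sub_le hC hκ (hgτ t₁) (hgf _) (hgf _) (z i)).trans ?_
    have e1 := h₁ (z i).2.1 (Finset.mem_image_of_mem _ (Finset.mem_univ i))
    have e2 := h₂ (z i).1 (Finset.mem_union_left _
      (Finset.mem_image_of_mem _ (Finset.mem_univ i)))
    have e3 := h₂ (z i).2.1 (Finset.mem_union_right _ (Finset.mem_union_left _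
      (Finset.mem_image_of_mem (fun i => (z i).2.1) (Finset.mem_univ i))))
    have e4 := h₂ (z i).2.2 (Finset.mem_union_right _ (Finset.mem_union_right _
      (Finset.mem_image_of_mem (fun i => (z i).2.2) (Finset.mem_univ i))))
    set δ : ℝ := 2 * C / N
    have hδ : 0 ≤ δ := by positivity
    have f1 : (1 - M.gamma) * |gf t.2 (z i).1 - gf t₂ (z i).1| ≤ 1 * δ :=
      mul_le_mul (by linarith) e2 (abs_nonneg _) zero_le_one
    have f2 : M.gamma * (C * |gf t.2 (z i).2.2 - gf t₂ (z i).2.2|) ≤ 1 * (C * δ) :=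
      mul_le_mul hγ1 (mul_le_mul_of_nonneg_left e4 hC) (by positivity) zero_le_one
    have f3 : C * κ * |gf t.2 (z i).2.1 - gf t₂ (z i).2.1| ≤ C * κ * δ :=
      mul_le_mul_of_nonneg_left e3 (by positivity)
    have f4 : (C + (|conj φ 0| + κ * C)) * |gτ t.1 (z i).2.1 - gτ t₁ (z i).2.1|
        ≤ (C + (|conj φ 0| + κ * C)) * δ := mul_le_mul_of_nonneg_left e1 (by positivity)
    unfold netScale
    linarith

theorem IsSample.isTripleLaw {Ξ : Type*} [MeasurableSpace Ξ] {Q : Measure Ξ} {N : ℕ}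
    {Z : Fin N → Ξ → (S × A) × (S × A) × (S × A)} (hZ : M.IsSample Q Z) (i : Fin N) :
    M.IsTripleLaw (Q.map (Z i)) where
  map_fst := by
    rw [Measure.map_map measurable_fst (hZ.measurable i)]
    exact hZ.law_init i
  map_snd := by
    rw [Measure.map_map measurable_snd (hZ.measurable i)]
    exact hZ.law_pair i

/-- Uniform deviation of the empirical losses. -/
theorem IsSample.exists_baseLoss_deviation {Ξ : Type*} [MeasurableSpace Ξ] {Q : Measure Ξ}
    [IsProbabilityMeasure Q] {N : ℕ} {Z : Fin N → Ξ → (S × A) × (S × A) × (S × A)}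
    (hZ : M.IsSample Q Z) (hN : 2 ≤ N) (i₀ : Fin N) (hC : 0 ≤ C)
    (hκ : LipschitzOnWith κ (conj φ) (Icc (-C) C)) {H F : Set (S × A → ℝ)}
    (hH : H ⊆ ratioBall C) (hF : F ⊆ dualBall C) (hHne : H.Nonempty) (hFne : F.Nonempty)
    (hHp : Permissible H) (hFp : Permissible F) {DH DF : ℕ} (hDH : pseudoDim H ≤ DH)
    (hDF : pseudoDim F ≤ DF) :
    ∃ h : Ξ → ℝ, Integrable h Q ∧
      (∀ ξ, ∀ τ ∈ H, ∀ f ∈ F, |(∑ i, M.baseLoss φ τ f (Z i ξ)) / N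
        - ∫ z, M.baseLoss φ τ f z ∂(Q.map (Z i₀))| ≤ h ξ) ∧
      ∫ ξ, h ξ ∂Q ≤ 2 * (4 * C * netScale φ C κ + (4 * (DH + DF : ℕ) + 1 + lossBound φ C κ ^ 2 / 2))
        * Real.sqrt (Real.log N / N) := by
  obtain ⟨T, _, _, gτ, hgτ, rfl⟩ := hHp
  obtain ⟨T', _, _, gf, hgf, rfl⟩ := hFp
  have : Nonempty T := range_nonempty_iff_nonempty.1 hHne
  have : Nonempty T' := range_nonempty_iff_nonempty.1 hFne
  have : IsProbabilityMeasure (Q.map (Z i₀)) :=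
    Measure.isProbabilityMeasure_map (hZ.measurable i₀).aemeasurable
  have hτ : ∀ t, gτ t ∈ ratioBall C := fun t => hH (mem_range_self t)
  have hf : ∀ t, gf t ∈ dualBall C := fun t => hF (mem_range_self t)
  obtain ⟨h, hi, hdev, hint⟩ := exists_uniform_deviation_bound (Q.map (Z i₀))
    (g := fun t : T × T' => M.baseLoss φ (gτ t.1) (gf t.2))
    (measurable_baseLoss_uncurry hκ hgτ hgf fun t => (hf t).2) (b := lossBound φ C κ)
    (fun t z => abs_baseLoss_le hC hκ (hτ t.1) (hf t.2).2 z) hN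
    (exists_finset_net_baseLoss hC hκ hτ (fun t => (hf t).2) hDH hDF hN)
    (log_two_mul_pow_le hN (DH + DF)) Q hZ.measurable hZ.indep fun i => hZ.ident i i₀
  refine ⟨h, hi, ?_, hint.trans ?_⟩
  · rintro ξ _ ⟨t, rfl⟩ _ ⟨t', rfl⟩
    exact hdev ξ (t, t')
  · have h1 := inv_le_two_mul_sqrt_log hN
    have h2 : 0 ≤ netScale φ C κ * (2 * C) := by unfold netScale; positivity
    have h3 := mul_le_mul_of_nonneg_left h1 h2
    have h4 : netScale φ C κ * (2 * C / N) = netScale φ C κ * (2 * C) * (1 / N) := by ring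
    rw [h4]
    linarith

/-- Uniform deviation of the empirical means of the ratios. -/
theorem IsSample.exists_ratio_deviation {Ξ : Type*} [MeasurableSpace Ξ] {Q : Measure Ξ}
    [IsProbabilityMeasure Q] {N : ℕ} {Z : Fin N → Ξ → (S × A) × (S × A) × (S × A)}
    (hZ : M.IsSample Q Z) (hN : 2 ≤ N) (hC : 0 ≤ C) {H : Set (S × A → ℝ)}
    (hH : H ⊆ ratioBall C) (hHne : H.Nonempty) (hHp : Permissible H) {DH : ℕ}
    (hDH : pseudoDim H ≤ DH) :
    ∃ h : Ξ → ℝ, Integrable h Q ∧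
      (∀ ξ, ∀ τ ∈ H, |(∑ i, τ (Z i ξ).2.1) / N - ∫ x, τ x ∂M.data| ≤ h ξ) ∧
      ∫ ξ, h ξ ∂Q ≤ 2 * (4 * C + (4 * DH + 1 + C ^ 2 / 2)) * Real.sqrt (Real.log N / N) := by
  classical
  obtain ⟨T, _, _, gτ, hgτ, rfl⟩ := hHp
  have : Nonempty T := range_nonempty_iff_nonempty.1 hHne
  have hN0 : 0 < N := by omega
  let i₀ : Fin N := ⟨0, hN0⟩
  have : IsProbabilityMeasure (Q.map (Z i₀)) :=
    Measure.isProbabilityMeasure_map (hZ.measurable i₀).aemeasurable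
  have hτ : ∀ t, gτ t ∈ ratioBall C := fun t => hH (mem_range_self t)
  have hmeas : Measurable (Function.uncurry fun (t : T) (z : (S × A) × (S × A) × (S × A)) =>
      gτ t z.2.1) :=
    hgτ.comp (by fun_prop : Measurable fun q : T × (S × A) × (S × A) × (S × A) => (q.1, q.2.2.1))
  have hnet : ∀ z : Fin N → (S × A) × (S × A) × (S × A), ∃ s : Finset T,
      (s.card : ℝ) ≤ (N ^ 4) ^ DH ∧
      ∀ t, ∃ t' ∈ s, ∀ i, |gτ t (z i).2.1 - gτ t' (z i).2.1| ≤ 2 * C / N := by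
    intro z
    obtain ⟨s, hs, hsn⟩ := exists_finset_net hDH (fun t => abs_le_of_mem_ratioBall (hτ t))
      (Finset.univ.image fun i => (z i).2.1) (n := N) (Finset.card_image_le.trans (by simp)) hN0
    refine ⟨s, ?_, fun t => ?_⟩
    · have h1 := hs.trans (Nat.pow_le_pow_left (succ_mul_le_pow_four hN (by omega)) DH)
      exact_mod_cast h1
    · obtain ⟨t', ht', h⟩ := hsn t
      exact ⟨t', ht', fun i => h _ (Finset.mem_image_of_mem (fun i => (z i).2.1)
        (Finset.mem_univ i))⟩
  obtain ⟨h, hi, hdev, hint⟩ := exists_uniform_deviation_bound (Q.map (Z i₀)) hmeas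
    (fun t z => abs_le_of_mem_ratioBall (hτ t) _) hN hnet
    (log_two_mul_pow_le hN DH) Q hZ.measurable hZ.indep fun i => hZ.ident i i₀
  refine ⟨h, hi, ?_, hint.trans ?_⟩
  · rintro ξ _ ⟨t, rfl⟩
    have h1 := hdev ξ t
    rwa [(hZ.isTripleLaw i₀).integral_data (hτ t).1] at h1
  · have h1 := inv_le_two_mul_sqrt_log hN
    have h3 := mul_le_mul_of_nonneg_left h1 (by positivity : 0 ≤ 2 * C)
    have h4 : 2 * C / N = 2 * C * (1 / N) := by ring
    rw [h4]
    linarith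

end StatisticalError

/-! ### The bounded comparison ratio and the final constant. -/

section Conclusion

variable {S A : Type*} [MeasurableSpace S] [MeasurableSpace A] {M : Problem S A} {C : ℝ}

/-- The truncation of a density ratio that is almost everywhere bounded by `C`. -/
theorem exists_mem_ratioBall_ae_eq_ratio (hC : 0 ≤ C) {μ : Measure (S × A)}
    (hμ : ∀ᵐ x ∂M.data, μ.rnDeriv M.data x ≤ ENNReal.ofReal C) :
    ∃ τ ∈ (ratioBall C : Set (S × A → ℝ)), M.ratio μ =ᵐ[M.data] τ := by
  -- Membership in `ratioBall` requires the bound at every point. Truncation alters the ratio only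
  -- on a null set, which the objective does not see (`objective_congr_ae`).
  refine ⟨fun x => min (M.ratio μ x) C, ⟨?_, fun x => ⟨?_, min_le_right _ _⟩⟩, ?_⟩
  · exact (Measure.measurable_rnDeriv μ M.data).ennreal_toReal.min measurable_const
  · exact le_min ENNReal.toReal_nonneg hC
  · filter_upwards [hμ] with x hx
    exact (min_eq_left (ENNReal.toReal_le_of_le_ofReal hC hx)).symm

/-- The constant of the error bound. -/
def errorConst (φ : ℝ → ℝ) (C : ℝ) (κ : NNReal) (lam : ℝ) (B : NNReal) (DH DF : ℕ) : ℝ :=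
  -- The maximum with 0 is needed because the constant is fixed before `0 ≤ C` is known; that sign
  -- follows only once `H` has a member.
  max 0 (((1 + C) * B + C * κ) + (C + (|conj φ 0| + κ * C) + lam * (C + 1))
    + 2 * (2 * (4 * C * netScale φ C κ + (4 * (DH + DF : ℕ) + 1 + lossBound φ C κ ^ 2 / 2))
      + lam * (C + 1) * (2 * (4 * C + (4 * DH + 1 + C ^ 2 / 2)))))

end Conclusion

end Problem

end GenDICE

end

/-! ### The error bound in expectation. -/

theorem theorem3 (φ : ℝ → ℝ) (hφ : GenDICE.IsDivergenceGenerator φ) (C : ℝ)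
    (hfin : GenDICE.ConjFiniteOn φ (Set.Icc (-C) C)) (κ : NNReal)
    (hκ : LipschitzOnWith κ (GenDICE.conj φ) (Set.Icc (-C) C))
    (lam : ℝ) (hlam : 0 < lam) (B : NNReal) (DH DF : ℕ) :
    ∃ K : ℝ, 0 ≤ K ∧
      ∀ (S A : Type*) [MeasurableSpace S] [MeasurableSpace A] (M : GenDICE.Problem S A)
        (_ : M.op M.data ≤ B • M.data)
        (μ : MeasureTheory.Measure (S × A)) (_ : M.IsUniqueStationary φ C μ)
        (_ : μ.AbsolutelyContinuous M.data)
        (_ : ∀ᵐ x ∂M.data, μ.rnDeriv M.data x ≤ ENNReal.ofReal C)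
        (H F : Set (S × A → ℝ))
        (_ : H ⊆ GenDICE.ratioBall C) (_ : F ⊆ GenDICE.dualBall C) (_ : F.Nonempty)
        (_ : GenDICE.Permissible H) (_ : GenDICE.Permissible F)
        (_ : GenDICE.pseudoDim H ≤ DH) (_ : GenDICE.pseudoDim F ≤ DF)
        (N : ℕ) (_ : 2 ≤ N)
        (Ξ : Type*) [MeasurableSpace Ξ] (Q : MeasureTheory.Measure Ξ)
        [MeasureTheory.IsProbabilityMeasure Q]
        (Z : Fin N → Ξ → (S × A) × (S × A) × (S × A)) (_ : M.IsSample Q Z)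
        (τhat : Ξ → S × A → ℝ) (_ : ∀ ξ, τhat ξ ∈ H)
        (_ : AEMeasurable (fun ξ => M.objective φ lam C (τhat ξ)) Q)
        (_ : AEMeasurable (fun ξ => M.optError φ lam H F (fun i => Z i ξ) (τhat ξ)) Q),
        MeasureTheory.Integrable
            (fun ξ => M.objective φ lam C (τhat ξ) - M.objective φ lam C (M.ratio μ)) Q ∧
        MeasureTheory.Integrable
            (fun ξ => M.optError φ lam H F (fun i => Z i ξ) (τhat ξ)) Q ∧
        ∫ ξ, (M.objective φ lam C (τhat ξ) - M.objective φ lam C (M.ratio μ)) ∂Q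
          ≤ K * (GenDICE.approxErrorDual M.data C F + GenDICE.approxErrorRatio M.data C H
              + Real.sqrt (Real.log N / N))
            + ∫ ξ, M.optError φ lam H F (fun i => Z i ξ) (τhat ξ) ∂Q := by
  refine ⟨GenDICE.Problem.errorConst φ C κ lam B DH DF, le_max_left _ _, ?_⟩
  intro S A _ _ M hB μ _ _ hμC H F hH hF hFne hHp hFp hDH hDF N hN Ξ _ Q _ Z hZ τhat hτ hJm hOm
  have hN0 : N ≠ 0 := by omega
  have hXne : Nonempty (S × A) := nonempty_of_isProbabilityMeasure M.data
  have hΞne : Nonempty Ξ := nonempty_of_isProbabilityMeasure Q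
  have hHne : H.Nonempty := ⟨_, hτ hΞne.some⟩
  have hC : 0 ≤ C := GenDICE.Problem.nonneg_of_mem_ratioBall (hH (hτ hΞne.some))
  let i₀ : Fin N := ⟨0, by omega⟩
  have hP := hZ.isTripleLaw i₀
  have hPprob : IsProbabilityMeasure (Q.map (Z i₀)) :=
    Measure.isProbabilityMeasure_map (hZ.measurable i₀).aemeasurable
  have hJi : Integrable (fun ξ => M.objective φ lam C (τhat ξ)) Q :=
    Integrable.of_bound hJm.aestronglyMeasurable _ (Filter.Eventually.of_forall fun ξ =>
      hP.abs_objective_le hC hκ (hH (hτ ξ)) hlam)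
  have hOi : Integrable (fun ξ => M.optError φ lam H F (fun i => Z i ξ) (τhat ξ)) Q :=
    Integrable.of_bound hOm.aestronglyMeasurable _ (Filter.Eventually.of_forall fun ξ =>
      GenDICE.Problem.abs_optError_le hC hκ hH hF hFne (hτ ξ) hlam hN0 _)
  have hdiff := hJi.sub (integrable_const (M.objective φ lam C (M.ratio μ)))
  refine ⟨hdiff, hOi, ?_⟩
  obtain ⟨τs, hτs, hae⟩ := GenDICE.Problem.exists_mem_ratioBall_ae_eq_ratio hC hμC
  obtain ⟨h₁, hi₁, hdev₁, hint₁⟩ := hZ.exists_baseLoss_deviation hN i₀ hC hκ hH hF hHne hFne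
    hHp hFp hDH hDF
  obtain ⟨h₂, hi₂, hdev₂, hint₂⟩ := hZ.exists_ratio_deviation hN hC hH hHne hHp hDH
  -- The deviation bounds hold at each `ξ` simultaneously for all members of `H` and `F`, so the
  -- dependence of `τhat` on the data and on extra randomness is harmless.
  have hpt : ∀ ξ, M.objective φ lam C (τhat ξ) - M.objective φ lam C (M.ratio μ)
      ≤ M.optError φ lam H F (fun i => Z i ξ) (τhat ξ)
        + (((1 + C) * B + C * κ) * GenDICE.approxErrorDual M.data C F
          + (C + (|GenDICE.conj φ 0| + κ * C) + lam * (C + 1))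
            * GenDICE.approxErrorRatio M.data C H
          + 2 * (h₁ ξ + lam * (C + 1) * h₂ ξ)) := by
    intro ξ
    rw [GenDICE.Problem.objective_congr_ae hae lam]
    have h := hP.objective_sub_le hC hκ hlam hB hH hF hFne hN0 (fun i => Z i ξ) (hdev₁ ξ)
      (hdev₂ ξ) (hτ ξ) hτs
    linarith
  have hi₃ : Integrable (fun ξ => h₁ ξ + lam * (C + 1) * h₂ ξ) Q := hi₁.add (hi₂.const_mul _)
  have hi₄ : Integrable (fun ξ => ((1 + C) * B + C * κ) * GenDICE.approxErrorDual M.data C F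
      + (C + (|GenDICE.conj φ 0| + κ * C) + lam * (C + 1)) * GenDICE.approxErrorRatio M.data C H
      + 2 * (h₁ ξ + lam * (C + 1) * h₂ ξ)) Q :=
    (integrable_const _).add (hi₃.const_mul 2)
  have hint := integral_mono hdiff (hOi.add hi₄) hpt
  have hval : ∫ ξ, (M.optError φ lam H F (fun i => Z i ξ) (τhat ξ)
        + (((1 + C) * B + C * κ) * GenDICE.approxErrorDual M.data C F
          + (C + (|GenDICE.conj φ 0| + κ * C) + lam * (C + 1))
            * GenDICE.approxErrorRatio M.data C H
          + 2 * (h₁ ξ + lam * (C + 1) * h₂ ξ))) ∂Q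
      = ∫ ξ, M.optError φ lam H F (fun i => Z i ξ) (τhat ξ) ∂Q
        + (((1 + C) * B + C * κ) * GenDICE.approxErrorDual M.data C F
          + (C + (|GenDICE.conj φ 0| + κ * C) + lam * (C + 1))
            * GenDICE.approxErrorRatio M.data C H
          + 2 * (∫ ξ, h₁ ξ ∂Q + lam * (C + 1) * ∫ ξ, h₂ ξ ∂Q)) := by
    rw [integral_add hOi hi₄, integral_add (integrable_const _) (hi₃.const_mul 2), integral_const_mul,
      integral_add hi₁ (hi₂.const_mul _), integral_const_mul]
    simp
  refine (hint.trans hval.le).trans ?_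
  rw [add_comm]
  gcongr ?_ + _
  set s := Real.sqrt (Real.log N / N)
  have hs : 0 ≤ s := Real.sqrt_nonneg _
  have hεF : 0 ≤ GenDICE.approxErrorDual M.data C F := GenDICE.approxErrorDual_nonneg
  have hεH : 0 ≤ GenDICE.approxErrorRatio M.data C H := GenDICE.approxErrorRatio_nonneg
  set k₁ : ℝ := (1 + C) * B + C * κ with hk₁
  set k₂ : ℝ := C + (|GenDICE.conj φ 0| + κ * C) + lam * (C + 1) with hk₂
  set k₃ : ℝ := 2 * (4 * C * GenDICE.Problem.netScale φ C κ + (4 * (DH + DF : ℕ) + 1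
    + GenDICE.Problem.lossBound φ C κ ^ 2 / 2)) with hk₃
  set k₄ : ℝ := 2 * (4 * C + (4 * DH + 1 + C ^ 2 / 2)) with hk₄
  have hk₁0 : 0 ≤ k₁ := by positivity
  have hk₂0 : 0 ≤ k₂ := by positivity
  have hk₃0 : 0 ≤ k₃ := by
    have : 0 ≤ GenDICE.Problem.netScale φ C κ := by
      unfold GenDICE.Problem.netScale
      positivity
    positivity
  have hk₄0 : 0 ≤ k₄ := by positivity
  have hl : 0 ≤ lam * (C + 1) := by positivity
  have hK : k₁ + k₂ + 2 * (k₃ + lam * (C + 1) * k₄)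
      ≤ GenDICE.Problem.errorConst φ C κ lam B DH DF := le_max_right _ _
  set K := GenDICE.Problem.errorConst φ C κ lam B DH DF
  have hk₄l : 0 ≤ lam * (C + 1) * k₄ := mul_nonneg hl hk₄0
  have e₁ := mul_le_mul_of_nonneg_right (by linarith : k₁ ≤ K) hεF
  have e₂ := mul_le_mul_of_nonneg_right (by linarith : k₂ ≤ K) hεH
  have e₃ := mul_le_mul_of_nonneg_right (by linarith : 2 * (k₃ + lam * (C + 1) * k₄) ≤ K) hs
  have e₄ := mul_le_mul_of_nonneg_left hint₂ hl
  linarith
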